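/- **Setting.** Let $P_1,P_2,P_3\in\mathbb R^2$ be non-collinear (for instance the vertices of an equilateral triangle of side one), let $T_1=\Delta(P_1,P_2,P_3)$ be the full triangle, and let $m\ge 2$. For non-negative integers $k=(k_1,k_2,k_3)$ with $k_1+k_2+k_3=m-1$ let $T_m(k)$ be the (upright) triangle with vertices $A_i=\frac1m\sum_j (k_j+\delta_{ij})P_j$, and for $k_1+k_2+k_3=m-2$ let $T'_m(k)$ be the (upside down) triangle with vertices $A_i=\frac1m\sum_j (k_j+1-\delta_{ij})P_j$, $i=1,2,3$. Denote by $\mathcal T_m,\mathcal T'_m$ the sets of these triangles. For a triangle $\Delta$ with vertices $A_1,A_2,A_3$, let $P_\Delta$ be the affine map with $P_\Delta(P_i)=A_i$. $T_m(k)$ and $T'_m(k')$ are *neighbours* if for some $j$, $k_j=k'_j+1$ and $k_i=k'_i$ for $i\neq j$. A *triangular labyrinth patterns system* consists of sets $\mathcal W,\mathcal Y\subseteq\mathcal T_m$ and $\mathcal W',\mathcal Y'\subseteq\mathcal T'_m$ such that: 1. (tree property) the graphs with vertex sets $\mathcal W\cup\mathcal W'$ and $\mathcal Y\cup\mathcal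 Y'$, whose edges join neighbours, are trees; 2. (exits property) there is exactly one triple $(k_1,k_2,k_3)$ of integers in $\{0,\dots,m-1\}$ such that $e_1^w:=T_m(0,k_1,m-1-k_1)$, $e_2^w:=T_m(k_2,0,m-1-k_2)$, $e_3^w:=T_m(k_3,m-1-k_3,0)$ lie in $\mathcal W$ and $e_1^y:=T_m(0,m-1-k_1,k_1)$, $e_2^y:=T_m(m-1-k_2,0,k_2)$, $e_3^y:=T_m(m-1-k_3,k_3,0)$ lie in $\mathcal Y$; 3. (corners property) $\mathcal W$ and $\mathcal Y$ each contain at most one triangle having one of $P_1,P_2,P_3$ as a vertex, and they have no such triangle in common. For a pair $\pi=\{i,j\}\subset\{1,2,3\}$ with $\{i,j,l\}=\{1,2,3\}$, the system is *$\pi$-blocked* if the path from $e_i^w$ to $e_j^w$ in the tree on $\mathcal W\cup\mathcal W'$, or the path from $e_i^y$ to $e_j^y$ in the tree on $\mathcal Y\cup\mathcal Y'$, contains two triangles with different $l$-th coordinate $k_l$. Put $\mathcal W_1=\mathcal W$, $\mathcal W'_1=\mathcal W'$, $\mathcal Y_1=\mathcal Y$, $\mathcal Y'_1=\mathcal Y'$,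 and for $n\ge 2$ $$\mathcal W_n=\{P_A(B):A\in\mathcal W_{n-1},B\in\mathcal W\}\cup\{P_A(B):A\in\mathcal W'_{n-1},B\in\mathcal Y'\},$$ $$\mathcal W'_n=\{P_A(B):A\in\mathcal W_{n-1},B\in\mathcal W'\}\cup\{P_A(B):A\in\mathcal W'_{n-1},B\in\mathcal Y\},$$ and define $\mathcal Y_n,\mathcal Y'_n$ in the same way with the roles of $\mathcal W,\mathcal W'$ and $\mathcal Y,\mathcal Y'$ exchanged. The white fractal is $L^{\mathrm{white}}_\infty=\bigcap_{n\ge1}\bigcup_{\Delta\in\mathcal W_n\cup\mathcal W'_n}\Delta$ and the yellow fractal is $L^{\mathrm{yellow}}_\infty=\bigcap_{n\ge1}\bigcup_{\Delta\in\mathcal Y_n\cup\mathcal Y'_n}\Delta$. A *non-trivial arc* is the image of $[0,1]$ under an injective continuous map into the plane, and its *length* is its one-dimensional Hausdorff (Lebesgue) measure. An arc $a$ *has a tangent* at $x_0\in a$ if there is a straight line $\tau$ through $x_0$ such that for every $\varphi>0$ there is $\varepsilon>0$ such that for every $x\in a$ with $0<|x-x_0|<\varepsilon$ the angle between $\tau$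 and the line through $x_0$ and $x$ is at most $\varphi$. **Theorem.** Suppose that a triangular labyrinth patterns system is $\pi$-blocked for exactly one pair $\pi\subset\{1,2,3\}$. Then for every non-trivial arc $a$ contained in $L^{\mathrm{white}}_\infty$ or in $L^{\mathrm{yellow}}_\infty$: (a) $a$ has finite length; (b) $a$ has Hausdorff dimension one; (c) $a$ has a tangent at almost every one of its points, with respect to one-dimensional Lebesgue measure (length) on $a$. -/

import Mathlib

open MeasureTheory
open scoped ENNReal

noncomputable section

namespace TriLaby

/-- The Euclidean plane. -/
abbrev Plane : Type := EuclideanSpace ℝ (Fin 2)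

/-! ### The triangular grid and patterns systems -/

/-- Index of a triangle of a triangular grid: `up k` stands for the upright triangle
`T_m(k₁,k₂,k₃)` and `down k` for the upside down triangle `T'_m(k₁,k₂,k₃)`.
Types `1, 2, 3` are the elements `0, 1, 2` of `Fin 3`. -/
inductive Cell : Type
  | up (k : Fin 3 → ℕ) : Cell
  | down (k : Fin 3 → ℕ) : Cell

/-- The triple `(k₁,k₂,k₃)` of a cell. Two cells lie in the same strip of type `i` iff their
`i`-th coordinates agree. -/
def Cell.coord : Cell → Fin 3 → ℕ
  | .up k => k
  | .down k => k

/-- The (indices of the) triangles into which the big triangle is divided at scale `1/m`. -/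
def grid (m : ℕ) : Set Cell :=
  {c | (∃ k : Fin 3 → ℕ, c = .up k ∧ k 0 + k 1 + k 2 + 1 = m) ∨
       (∃ k : Fin 3 → ℕ, c = .down k ∧ k 0 + k 1 + k 2 + 2 = m)}

/-- `c` is upright, `d` is upside down, and they are `j`-neighbours, i.e. they share their side
of type `j`. -/
def IsNeighbour (j : Fin 3) (c d : Cell) : Prop :=
  ∃ k k' : Fin 3 → ℕ, c = .up k ∧ d = .down k' ∧ k j = k' j + 1 ∧ ∀ i, i ≠ j → k i = k' i

/-- Adjacency of triangles: being `j`-neighbours for some `j`. -/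
def cellGraph : SimpleGraph Cell :=
  SimpleGraph.fromRel fun c d => ∃ j, IsNeighbour j c d

/-- An `m`-triangular patterns system: a white and a yellow set of triangles of the grid.
`𝒲`, `𝒲'` are the upright and the upside down triangles of `white`; similarly for `yellow`. -/
structure PatternsSystem (m : ℕ) where
  white : Set Cell
  yellow : Set Cell
  white_sub : white ⊆ grid m
  yellow_sub : yellow ⊆ grid m

/-- The white exits described by a triple. -/
def whiteExit (m : ℕ) (k : Fin 3 → ℕ) : Fin 3 → Cell :=
  ![.up ![0, k 0, m - 1 - k 0], .up ![k 1, 0, m - 1 - k 1], .up ![k 2, m - 1 - k 2, 0]]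

/-- The yellow exits described by a triple. -/
def yellowExit (m : ℕ) (k : Fin 3 → ℕ) : Fin 3 → Cell :=
  ![.up ![0, m - 1 - k 0, k 0], .up ![m - 1 - k 1, 0, k 1], .up ![m - 1 - k 2, k 2, 0]]

/-- The upright triangles of a pattern that contain a vertex of the big triangle. -/
def corners (pat : Set Cell) : Set Cell :=
  {c | c ∈ pat ∧ ∃ k : Fin 3 → ℕ, c = .up k ∧ k 0 * k 1 + k 0 * k 2 + k 1 * k 2 = 0}

namespace PatternsSystem

variable {m : ℕ}

/-- The triple `k` describes exits of the system. -/
def IsExitTriple (S : PatternsSystem m) (k : Fin 3 → ℕ) : Prop :=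
  (∀ i, k i < m) ∧ ∀ i, whiteExit m k i ∈ S.white ∧ yellowExit m k i ∈ S.yellow

/-- Triangular labyrinth patterns systems: the tree, exits and corners properties. -/
structure IsLabyrinth (S : PatternsSystem m) : Prop where
  white_tree : (cellGraph.induce S.white).IsTree
  yellow_tree : (cellGraph.induce S.yellow).IsTree
  exits : ∃! k : Fin 3 → ℕ, S.IsExitTriple k
  corners_disjoint : Disjoint (corners S.white) (corners S.yellow)
  white_corners : (corners S.white).Subsingleton
  yellow_corners : (corners S.yellow).Subsingleton

end PatternsSystem

/-! ### Blocked systems -/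

/-- The set of unordered pairs of types. -/
def exitPairs : Finset (Finset (Fin 3)) := (Finset.univ : Finset (Fin 3)).powersetCard 2

/-- The path inside the pattern `pat` between the exits `e i` and `e j`, where `π = {i, j}`,
contains two triangles that are not in the same strip of type `l`, where `l` is the third type. -/
def PathBlocked (pat : Set Cell) (e : Fin 3 → Cell) (π : Finset (Fin 3)) : Prop :=
  ∃ i j l : Fin 3, i ≠ j ∧ π = {i, j} ∧ l ∉ π ∧
    ∃ p : cellGraph.Walk (e i) (e j), p.IsPath ∧ (∀ c ∈ p.support, c ∈ pat) ∧
      ∃ c ∈ p.support, ∃ d ∈ p.support, c.coord l ≠ d.coord l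

/-- The system is `π`-blocked: the white or the yellow path of type `π` is blocked. (For a
labyrinth patterns system the exit triple and the path are unique.) -/
def PatternsSystem.IsBlocked {m : ℕ} (S : PatternsSystem m) (π : Finset (Fin 3)) : Prop :=
  ∃ k, S.IsExitTriple k ∧
    (PathBlocked S.white (whiteExit m k) π ∨ PathBlocked S.yellow (yellowExit m k) π)

/-! ### The fractals

The vertices `P₁, P₂, P₃` of the big triangle are three arbitrary non-collinear points of the
plane, i.e. an affine basis. -/

/-- A triangle, given by its vertices `A₁, A₂, A₃`. -/
abbrev Triangle : Type := Fin 3 → Plane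

/-- The full triangle `Δ(A₁,A₂,A₃)`. -/
def Triangle.carrier (A : Triangle) : Set Plane := convexHull ℝ (Set.range A)

/-- The projection map onto the triangle `A`: the point with barycentric coordinates
`(α₁,α₂,α₃)` with respect to `P` goes to `α₁ A₁ + α₂ A₂ + α₃ A₃`. -/
def proj (P : AffineBasis (Fin 3) ℝ Plane) (A : Triangle) (x : Plane) : Plane :=
  ∑ i, P.coord i x • A i

/-- The triangle `T_m(k₁,k₂,k₃)` or `T'_m(k₁,k₂,k₃)` with its vertices. -/
def cellTriangle (P : AffineBasis (Fin 3) ℝ Plane) (m : ℕ) : Cell → Triangle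
  | .up k => fun i => (m : ℝ)⁻¹ • ∑ j, ((k j : ℝ) + if j = i then 1 else 0) • P j
  | .down k => fun i => (m : ℝ)⁻¹ • ∑ j, ((k j : ℝ) + if j = i then 0 else 1) • P j

/-- The image of the triangle `B` under the projection map onto the triangle `A`. -/
def place (P : AffineBasis (Fin 3) ℝ Plane) (A B : Triangle) : Triangle :=
  fun i => proj P A (B i)

/-- The upright triangles of a pattern. -/
def upTriangles (P : AffineBasis (Fin 3) ℝ Plane) (m : ℕ) (pat : Set Cell) : Set Triangle :=
  {A | ∃ k, Cell.up k ∈ pat ∧ A = cellTriangle P m (.up k)}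

/-- The upside down triangles of a pattern. -/
def downTriangles (P : AffineBasis (Fin 3) ℝ Plane) (m : ℕ) (pat : Set Cell) : Set Triangle :=
  {A | ∃ k, Cell.down k ∈ pat ∧ A = cellTriangle P m (.down k)}

/-- `level P m own other n` is the pair (upright, upside down) of sets of triangles of level
`n + 1`. It starts with the pattern `own`; each upright triangle is then replaced by a copy of
`own` and each upside down triangle by a copy of `other` (which exchanges the orientations).
White triangles arise for `own` white and `other` yellow, yellow triangles with exchanged
roles. -/
def level (P : AffineBasis (Fin 3) ℝ Plane) (m : ℕ) (own other : Set Cell) :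
    ℕ → Set Triangle × Set Triangle
  | 0 => (upTriangles P m own, downTriangles P m own)
  | n + 1 =>
    let L := level P m own other n
    (Set.image2 (place P) L.1 (upTriangles P m own) ∪
        Set.image2 (place P) L.2 (downTriangles P m other),
      Set.image2 (place P) L.1 (downTriangles P m own) ∪
        Set.image2 (place P) L.2 (upTriangles P m other))

/-- The intersection over all levels of the union of all triangles of that level. -/
def limitSet (P : AffineBasis (Fin 3) ℝ Plane) (m : ℕ) (own other : Set Cell) : Set Plane :=
  ⋂ n : ℕ, ⋃ A ∈ (level P m own other n).1 ∪ (level P m own other n).2, A.carrier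

/-- The white triangular labyrinth fractal. -/
def PatternsSystem.whiteFractal {m : ℕ} (S : PatternsSystem m)
    (P : AffineBasis (Fin 3) ℝ Plane) : Set Plane :=
  limitSet P m S.white S.yellow

/-- The yellow triangular labyrinth fractal. -/
def PatternsSystem.yellowFractal {m : ℕ} (S : PatternsSystem m)
    (P : AffineBasis (Fin 3) ℝ Plane) : Set Plane :=
  limitSet P m S.yellow S.white

/-! ### Arcs and tangents -/

/-- A non-trivial arc: the image of `[0,1]` under an injective continuous map. -/
def IsArc (A : Set Plane) : Prop :=
  ∃ γ : unitInterval → Plane, Continuous γ ∧ Function.Injective γ ∧ Set.range γ = A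

/-- The angle in `[0, π/2]` between two straight lines with directions `v` and `w`. -/
def lineAngle (v w : Plane) : ℝ :=
  min (InnerProductGeometry.angle v w) (InnerProductGeometry.angle v (-w))

/-- `A` has a tangent at `x₀`: there is a straight line through `x₀` with direction `v` such that
for every `φ > 0`, the angle between this line and the line through `x₀` and `x` is at most `φ`
for all `x ∈ A` different from `x₀` and close enough to `x₀`. -/
def HasTangentAt (A : Set Plane) (x₀ : Plane) : Prop :=
  ∃ v : Plane, v ≠ 0 ∧ ∀ φ : ℝ, 0 < φ → ∃ ε : ℝ, 0 < ε ∧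
    ∀ x ∈ A, x ≠ x₀ → dist x₀ x < ε → lineAngle v (x - x₀) ≤ φ

end TriLaby

end

noncomputable section
namespace TriLaby

/-! ### Cells in barycentric coordinates -/

/-! In barycentric coordinates each of the two fractals is covered by copies of ratio `1/m` in the
cells of its pattern: an upright cell carries a copy of the same colour, an upside down cell a
half-turned copy of the other colour. Because of the corners property, pieces in different cells can
meet only across a common side, and because the exit triple is unique they can meet there only in
the exit point of that side, the fixed point of the map of the exit cell (`piece_inter`). Together
with the tree property this shows that an injective path stays in a piece between two visits, spends
time only in cells on any walk joining the cells of its endpoints, and passes from cell to cell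
through exits (`TreeLike.mem_of_between`, `TreeLike.mem_support`, `exit_of_mem`).

Let `l` be the type missing from the blocked pair. For each `r ≠ l` the exits of type different from
`r` are joined inside one strip of type `r`, so the exits of each colour lie on two lines `x r =
const`, `r ≠ l`, both through the exit of type `l`. A path between two exits of type different from
`r` stays in such strips at all scales; since the distance to the line is divided by `m` at each
scale, the path is straight (`StraightAlong.path_eq`). For the remaining pair the tree route can be
taken through the exit of type `l`, so each visited cell lies in one of the two strips, and the same
contraction applied to the product of the two distances puts the path on the two lines
(`StraightAlong.path_mem_lines`).

An arbitrary arc crosses all its cells from exit to exit, except the first and the last one. So it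
consists of a part on finitely many lines and two arcs that are treated in the same way one scale
further. After `n` scales there remain `2 ^ n` pieces of diameter `m ^ (-n)` and a part of bounded
length on finitely many lines (`StraightAlong.approx`). Straightness and the corners property force
`m ≥ 3`, so `2 ^ n * m ^ (-n)` tends to zero. This gives finite length. Moreover almost every point
avoids the remainder of some scale and is no crossing point of two of the countably many lines; near
it the arc lies in a single line, which is the tangent. Finite length bounds the dimension by one,
and a coordinate projection gives the reverse bound. -/

/-- The projection map onto a cell, in barycentric coordinates. -/
def cellMap (m : ℕ) : Cell → (Fin 3 → ℝ) → (Fin 3 → ℝ)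
  | .up k, z => fun r => (k r + z r) / m
  | .down k, z => fun r => (k r + 1 - z r) / m

/-- The colour of the copy of the patterns that refines a cell in a pattern of colour `b`. -/
def Cell.kind (b : Bool) : Cell → Bool
  | .up _ => b
  | .down _ => !b

/-- The combinatorial properties of a labyrinth patterns system with patterns `pat true` (white)
and `pat false` (yellow) and exits `Cell.up (ex b p)`. -/
structure LabyrinthData (m : ℕ) (pat : Bool → Set Cell) (ex : Bool → Fin 3 → Fin 3 → ℕ) :
    Prop where
  two_le : 2 ≤ m
  sub : ∀ b, pat b ⊆ grid m
  acyclic : ∀ b, (cellGraph.induce (pat b)).IsAcyclic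
  ex_mem : ∀ b p, Cell.up (ex b p) ∈ pat b
  ex_self : ∀ b p, ex b p p = 0
  ex_mirror : ∀ b p q, q ≠ p → ex b p q + ex (!b) p q + 1 = m
  ex_unique : ∀ b p k k', Cell.up k ∈ pat b → Cell.up k' ∈ pat (!b) → k p = 0 → k' p = 0 →
    (∀ q, q ≠ p → k q + k' q + 1 = m) → k = ex b p
  corner_unique : ∀ b k k' q r, Cell.up k ∈ pat b → Cell.up k' ∈ pat b →
    k q + 1 = m → k' r + 1 = m → q = r
  corner_ne : ∀ b k k' q r, Cell.up k ∈ pat b → Cell.up k' ∈ pat (!b) →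
    k q + 1 = m → k' r + 1 = m → q ≠ r

/-- A pair of closed sets that is covered by the copies of itself in the cells of the patterns. -/
structure FractalPair (m : ℕ) (pat : Bool → Set Cell) (K : Bool → Set (Fin 3 → ℝ)) : Prop where
  closed : ∀ b, IsClosed (K b)
  sub_simplex : ∀ b, K b ⊆ stdSimplex ℝ (Fin 3)
  cover : ∀ b, ∀ z ∈ K b, ∃ c ∈ pat b, ∃ w ∈ K (c.kind b), z = cellMap m c w

/-- The exit points. -/
def exitPoint (m : ℕ) (ex : Bool → Fin 3 → Fin 3 → ℕ) (b : Bool) (p : Fin 3) : Fin 3 → ℝ :=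
  fun q => ex b p q / ((m : ℝ) - 1)

lemma sum_three {M : Type*} [AddCommMonoid M] (f : Fin 3 → M) {i j l : Fin 3} (hij : i ≠ j)
    (hil : i ≠ l) (hjl : j ≠ l) : f 0 + f 1 + f 2 = f i + f j + f l := by
  fin_cases i <;> fin_cases j <;> fin_cases l <;> simp at * <;> abel

lemma exists_other (p q : Fin 3) : ∃ r, r ≠ p ∧ r ≠ q := by
  revert p q; decide

lemma exists_others (p : Fin 3) : ∃ q r, q ≠ p ∧ r ≠ p ∧ q ≠ r ∧ ∀ s, s ≠ p → s = q ∨ s = r := by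
  revert p; decide

lemma eq_zero_of_abs_le_pow {m : ℕ} (hm : 2 ≤ m) {x : ℝ} (h : ∀ n : ℕ, |x| ≤ (1 / (m : ℝ)) ^ n) :
    x = 0 := by
  have hm' : (2 : ℝ) ≤ m := by exact_mod_cast hm
  have h1 : Filter.Tendsto (fun n : ℕ => (1 / (m : ℝ)) ^ n) Filter.atTop (nhds 0) := by
    apply tendsto_pow_atTop_nhds_zero_of_lt_one (by positivity)
    rw [div_lt_one (by linarith)]; linarith
  have := ge_of_tendsto' h1 h
  exact abs_eq_zero.1 (le_antisymm this (abs_nonneg x))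

lemma simplex_sum {z : Fin 3 → ℝ} (hz : z ∈ stdSimplex ℝ (Fin 3)) : z 0 + z 1 + z 2 = 1 := by
  rw [← hz.2, Fin.sum_univ_three]

lemma simplex_le {z : Fin 3 → ℝ} (hz : z ∈ stdSimplex ℝ (Fin 3)) (q : Fin 3) : z q ≤ 1 := by
  have := simplex_sum hz
  have h0 := hz.1 0
  have h1 := hz.1 1
  have h2 := hz.1 2
  fin_cases q <;> simp <;> linarith

lemma grid_up {m : ℕ} {k : Fin 3 → ℕ} (h : Cell.up k ∈ grid m) : k 0 + k 1 + k 2 + 1 = m := by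
  rcases h with ⟨k', h, h'⟩ | ⟨k', h, h'⟩
  · cases h; exact h'
  · cases h

lemma grid_down {m : ℕ} {k : Fin 3 → ℕ} (h : Cell.down k ∈ grid m) :
    k 0 + k 1 + k 2 + 2 = m := by
  rcases h with ⟨k', h, h'⟩ | ⟨k', h, h'⟩
  · cases h
  · cases h; exact h'

lemma cellMap_injective {m : ℕ} (hm : 2 ≤ m) (c : Cell) : Function.Injective (cellMap m c) := by
  have hm' : (m : ℝ) ≠ 0 := by positivity
  intro z w h
  funext r
  have := congrFun h r
  cases c <;> simp only [cellMap] at this <;> field_simp at this <;> linarith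

namespace LabyrinthData

variable {m : ℕ} {pat : Bool → Set Cell} {ex : Bool → Fin 3 → Fin 3 → ℕ}
  {K : Bool → Set (Fin 3 → ℝ)}

lemma le_up (D : LabyrinthData m pat ex) {b : Bool} {k : Fin 3 → ℕ} (h : Cell.up k ∈ pat b)
    (q : Fin 3) : k q + 1 ≤ m := by
  have := grid_up (D.sub b h)
  fin_cases q <;> simp <;> omega

lemma le_down (D : LabyrinthData m pat ex) {b : Bool} {k : Fin 3 → ℕ} (h : Cell.down k ∈ pat b)
    (q : Fin 3) : k q + 2 ≤ m := by
  have := grid_down (D.sub b h)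
  fin_cases q <;> simp <;> omega

lemma one_lt_cast (D : LabyrinthData m pat ex) : (1 : ℝ) < m := by
  have := D.two_le
  exact_mod_cast (by omega : 1 < m)

lemma exitPoint_mem_Icc (D : LabyrinthData m pat ex) (b : Bool) (p q : Fin 3) :
    exitPoint m ex b p q ∈ Set.Icc (0 : ℝ) 1 := by
  have h1 := D.one_lt_cast
  have h2 : (ex b p q : ℝ) + 1 ≤ m := by exact_mod_cast D.le_up (D.ex_mem b p) q
  constructor
  · exact div_nonneg (by positivity) (by linarith)
  · rw [exitPoint, div_le_one (by linarith)]; linarith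

lemma exitPoint_fixed (D : LabyrinthData m pat ex) (b : Bool) (p : Fin 3) :
    cellMap m (.up (ex b p)) (exitPoint m ex b p) = exitPoint m ex b p := by
  have h1 := D.one_lt_cast
  have : (m : ℝ) - 1 ≠ 0 := by linarith
  funext q
  simp only [cellMap, exitPoint]
  field_simp
  ring

/-! ### Vertices in the fractals and meeting points of pieces. -/

/-- Upside down cells do not touch the vertices of the big triangle, so a vertex in the fractal can
only come from a corner cell. This transfers the corners property from the patterns to the fractals.
-/
lemma corner_mem (D : LabyrinthData m pat ex) (F : FractalPair m pat K) {b : Bool}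
    {w : Fin 3 → ℝ} (hw : w ∈ K b) {q : Fin 3} (hq : w q = 1) :
    ∃ k, Cell.up k ∈ pat b ∧ k q + 1 = m := by
  have h1 := D.one_lt_cast
  obtain ⟨c, hc, z, hz, rfl⟩ := F.cover b w hw
  have hzs := F.sub_simplex _ hz
  cases c with
  | up k =>
    refine ⟨k, hc, le_antisymm (D.le_up hc q) ?_⟩
    simp only [cellMap] at hq
    rw [div_eq_one_iff_eq (by linarith)] at hq
    have : (m : ℝ) ≤ k q + 1 := by linarith [simplex_le hzs q]
    exact_mod_cast this
  | down k =>
    exfalso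
    simp only [cellMap] at hq
    rw [div_eq_one_iff_eq (by linarith)] at hq
    have : (m : ℝ) ≤ k q + 1 := by linarith [hzs.1 q]
    have h3 : m ≤ k q + 1 := by exact_mod_cast this
    have := D.le_down hc q
    omega

lemma corner_eq (D : LabyrinthData m pat ex) (F : FractalPair m pat K) {b : Bool}
    {w w' : Fin 3 → ℝ} (hw : w ∈ K b) (hw' : w' ∈ K b) {q r : Fin 3} (hq : w q = 1)
    (hr : w' r = 1) : q = r := by
  obtain ⟨k, hk, hk'⟩ := D.corner_mem F hw hq
  obtain ⟨l, hl, hl'⟩ := D.corner_mem F hw' hr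
  exact D.corner_unique b k l q r hk hl hk' hl'

lemma corner_ne' (D : LabyrinthData m pat ex) (F : FractalPair m pat K) {b : Bool}
    {w w' : Fin 3 → ℝ} (hw : w ∈ K b) (hw' : w' ∈ K (!b)) {q r : Fin 3} (hq : w q = 1)
    (hr : w' r = 1) : q ≠ r := by
  obtain ⟨k, hk, hk'⟩ := D.corner_mem F hw hq
  obtain ⟨l, hl, hl'⟩ := D.corner_mem F hw' hr
  exact D.corner_ne b k l q r hk hl hk' hl'

/-- A point on the side `p` of the white triangle whose mirror image belongs to the yellow one is
contained in the exits, and the same relation holds between the corresponding points. -/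
lemma exit_step (D : LabyrinthData m pat ex) (F : FractalPair m pat K) {b : Bool}
    {z z' : Fin 3 → ℝ} (hz : z ∈ K b) (hz' : z' ∈ K (!b)) {p : Fin 3} (hp : z p = 0)
    (hp' : z' p = 0) (h : ∀ q, q ≠ p → z q + z' q = 1) :
    ∃ w ∈ K b, ∃ w' ∈ K (!b), w p = 0 ∧ w' p = 0 ∧ (∀ q, q ≠ p → w q + w' q = 1) ∧
      z = cellMap m (.up (ex b p)) w := by
  have h1 := D.one_lt_cast
  have hm0 : (m : ℝ) ≠ 0 := by linarith
  have hmpos : (0 : ℝ) < m := by linarith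
  obtain ⟨c, hc, w, hw, rfl⟩ := F.cover b z hz
  obtain ⟨d, hd, w', hw', rfl⟩ := F.cover _ z' hz'
  have hws := F.sub_simplex _ hw
  have hws' := F.sub_simplex _ hw'
  obtain ⟨q, r, hq, hr, hqr, hall⟩ := exists_others p
  have hsum := simplex_sum hws
  have hsum' := simplex_sum hws'
  rw [sum_three w hq.symm hr.symm hqr] at hsum
  rw [sum_three w' hq.symm hr.symm hqr] at hsum'
  have hwp := hws.1 p
  have hwq := hws.1 q
  have hwr := hws.1 r
  have hwp' := hws'.1 p
  have hwq' := hws'.1 q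
  have hwr' := hws'.1 r
  have heq := h q hq
  have her := h r hr
  cases c with
  | up k =>
    have hg := grid_up (D.sub _ hc)
    rw [sum_three k hq.symm hr.symm hqr] at hg
    simp only [cellMap, div_eq_zero_iff, hm0, or_false] at hp
    have hkp0 : (0 : ℝ) ≤ k p := by positivity
    have hwp0 : w p = 0 := by linarith
    have hkp : k p = 0 := by exact_mod_cast (by linarith : (k p : ℝ) = 0)
    cases d with
    | up k' =>
      have hg' := grid_up (D.sub _ hd)
      rw [sum_three k' hq.symm hr.symm hqr] at hg'
      simp only [cellMap, div_eq_zero_iff, hm0, or_false] at hp'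
      have hkp0' : (0 : ℝ) ≤ k' p := by positivity
      have hwp0' : w' p = 0 := by linarith
      have hkp' : k' p = 0 := by exact_mod_cast (by linarith : (k' p : ℝ) = 0)
      simp only [cellMap] at heq her
      rw [← add_div, div_eq_one_iff_eq hm0] at heq her
      simp only [Cell.kind] at hw hw'
      -- Equality forces `w s + w' s = 2`, so both colours would contain the vertex `s`.
      have nocorner : ∀ s, s ≠ p → ¬ (m ≤ k s + k' s + 2 ∧ k s + k' s + 2 ≤ m) := by
        rintro s hs ⟨h2, h3⟩
        have h2' : (k s : ℝ) + k' s + 2 = m := by exact_mod_cast (by omega : k s + k' s + 2 = m)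
        have h4 : w s = 1 ∧ w' s = 1 := by
          rcases hall s hs with rfl | rfl <;> constructor <;> linarith
        exact D.corner_ne' F hw hw' h4.1 h4.2 rfl
      have hq1 : m ≤ k q + k' q + 2 := by
        exact_mod_cast (by linarith : (m : ℝ) ≤ k q + k' q + 2)
      have hr1 : m ≤ k r + k' r + 2 := by
        exact_mod_cast (by linarith : (m : ℝ) ≤ k r + k' r + 2)
      have hq2 := nocorner q hq
      have hr2 := nocorner r hr
      -- Both sums `k s + k' s` are at least `m - 1`, and together they are `2 * m - 2`.
      have hq3 : k q + k' q + 1 = m := by omega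
      have hr3 : k r + k' r + 1 = m := by omega
      have hk : k = ex b p := D.ex_unique b p k k' hc hd hkp hkp' (by
        intro s hs
        rcases hall s hs with rfl | rfl
        · exact hq3
        · exact hr3)
      refine ⟨w, hw, w', hw', hwp0, hwp0', ?_, by rw [hk]⟩
      have hq3' : (k q : ℝ) + k' q + 1 = m := by exact_mod_cast hq3
      have hr3' : (k r : ℝ) + k' r + 1 = m := by exact_mod_cast hr3
      intro s hs
      rcases hall s hs with rfl | rfl <;> linarith
    | down k' =>
      exfalso
      simp only [cellMap, div_eq_zero_iff, hm0, or_false] at hp'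
      have hkp0' : (0 : ℝ) ≤ k' p := by positivity
      have hwp1 : w' p = 1 := by linarith [simplex_le hws' p]
      simp only [cellMap] at heq her
      rw [← add_div, div_eq_one_iff_eq hm0] at heq her
      simp only [Cell.kind, Bool.not_not] at hw hw'
      have e1 : (k q : ℝ) + k' q + 1 + w q = m := by linarith
      have e2 : (k r : ℝ) + k' r + 1 + w r = m := by linarith
      -- The upside down cell touches side `p` only in its vertex, so `w'` is the vertex `p`. By
      -- integrality `w` is then one of the vertices `q`, `r`, and both points belong to the same
      -- colour.
      by_cases hwq1 : w q = 1
      · exact hq (D.corner_eq F hw hw' hwq1 hwp1)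
      · have : w q < 1 := lt_of_le_of_ne (simplex_le hws q) hwq1
        have h5 : m < k q + k' q + 2 := by
          exact_mod_cast (by linarith : (m : ℝ) < k q + k' q + 2)
        have h6 : k q + k' q + 1 ≤ m := by
          exact_mod_cast (by linarith : (k q : ℝ) + k' q + 1 ≤ m)
        have h7 : (k q : ℝ) + k' q + 1 = m := by
          exact_mod_cast (by omega : k q + k' q + 1 = m)
        exact hr (D.corner_eq F hw hw' (by linarith : w r = 1) hwp1)
  | down k =>
    exfalso
    simp only [cellMap, div_eq_zero_iff, hm0, or_false] at hp
    have hkp0 : (0 : ℝ) ≤ k p := by positivity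
    have hwp1 : w p = 1 := by linarith [simplex_le hws p]
    cases d with
    | up k' =>
      simp only [cellMap, div_eq_zero_iff, hm0, or_false] at hp'
      have hkp0' : (0 : ℝ) ≤ k' p := by positivity
      have hwp0' : w' p = 0 := by linarith
      simp only [cellMap] at heq her
      rw [← add_div, div_eq_one_iff_eq hm0] at heq her
      simp only [Cell.kind] at hw hw'
      by_cases hwq1 : w' q = 1
      · exact hq (D.corner_eq F hw' hw hwq1 hwp1)
      · have : w' q < 1 := lt_of_le_of_ne (simplex_le hws' q) hwq1
        have h5 : m < k q + k' q + 2 := by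
          exact_mod_cast (by linarith : (m : ℝ) < k q + k' q + 2)
        have h6 : k q + k' q + 1 ≤ m := by
          exact_mod_cast (by linarith : (k q : ℝ) + k' q + 1 ≤ m)
        have h7 : (k q : ℝ) + k' q + 1 = m := by
          exact_mod_cast (by omega : k q + k' q + 1 = m)
        exact hr (D.corner_eq F hw' hw (by linarith : w' r = 1) hwp1)
    | down k' =>
      simp only [cellMap, div_eq_zero_iff, hm0, or_false] at hp'
      have hkp0' : (0 : ℝ) ≤ k' p := by positivity
      have hwp1' : w' p = 1 := by linarith [simplex_le hws' p]
      simp only [Cell.kind, Bool.not_not] at hw hw'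
      exact D.corner_ne' F hw' hw hwp1' hwp1 rfl

/-- The hypotheses on `z`, `z'` describe a common point of two neighbouring pieces, seen from both
cells. `exit_step` reproduces them inside the exit cell, whose map contracts by `1/m` and fixes the
exit point; iteration leaves only that point. -/
lemma eq_exitPoint (D : LabyrinthData m pat ex) (F : FractalPair m pat K) {b : Bool}
    {z z' : Fin 3 → ℝ} (hz : z ∈ K b) (hz' : z' ∈ K (!b)) {p : Fin 3} (hp : z p = 0)
    (hp' : z' p = 0) (h : ∀ q, q ≠ p → z q + z' q = 1) : z = exitPoint m ex b p := by
  have h1 := D.one_lt_cast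
  have key : ∀ n : ℕ, ∀ z ∈ K b, ∀ z' ∈ K (!b), z p = 0 → z' p = 0 →
      (∀ q, q ≠ p → z q + z' q = 1) → ∀ q, |z q - exitPoint m ex b p q| ≤ (1 / (m : ℝ)) ^ n := by
    intro n
    induction n with
    | zero =>
      intro z hz _ _ _ _ _ q
      have h2 := D.exitPoint_mem_Icc b p q
      have h3 := (F.sub_simplex _ hz).1 q
      have h4 := simplex_le (F.sub_simplex _ hz) q
      rw [pow_zero, abs_le]
      constructor <;> linarith [h2.1, h2.2]
    | succ n ih =>
      intro z hz z' hz' hp hp' h q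
      obtain ⟨w, hw, w', hw', e1, e2, e3, e4⟩ := D.exit_step F hz hz' hp hp' h
      have h5 := ih w hw w' hw' e1 e2 e3 q
      have h6 := congrFun (D.exitPoint_fixed b p) q
      rw [e4, ← h6]
      simp only [cellMap]
      rw [← sub_div, add_sub_add_left_eq_sub, abs_div, Nat.abs_cast, pow_succ, div_eq_mul_one_div]
      gcongr
  funext q
  exact sub_eq_zero.1 (eq_zero_of_abs_le_pow D.two_le fun n => key n z hz z' hz' hp hp' h q)

/-- Up and down cells of a pattern whose pieces meet are neighbours. -/
lemma piece_inter_up_down (D : LabyrinthData m pat ex) (F : FractalPair m pat K) {b : Bool}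
    {k k' : Fin 3 → ℕ} (hc : Cell.up k ∈ pat b) (hd : Cell.down k' ∈ pat b) {w w' : Fin 3 → ℝ}
    (hw : w ∈ K b) (hw' : w' ∈ K (!b)) (h : cellMap m (.up k) w = cellMap m (.down k') w') :
    ∃ p, IsNeighbour p (.up k) (.down k') ∧ w = exitPoint m ex b p ∧
      w' = exitPoint m ex (!b) p := by
  have h1 := D.one_lt_cast
  have hm0 : (m : ℝ) ≠ 0 := by linarith
  have hws := F.sub_simplex _ hw
  have hws' := F.sub_simplex _ hw'
  have heq : ∀ q, (k q : ℝ) + w q = k' q + 1 - w' q := by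
    intro q
    have := congrFun h q
    simp only [cellMap] at this
    field_simp at this
    linarith
  have hle : ∀ q, k q ≤ k' q + 1 := by
    intro q
    exact_mod_cast (by linarith [heq q, hws.1 q, hws'.1 q] : (k q : ℝ) ≤ k' q + 1)
  -- Otherwise `w` and `w'` would both be the vertex `q`, although their colours differ.
  have hge : ∀ q, k' q ≤ k q := by
    intro q
    by_contra hlt
    have h2 : (k q : ℝ) + 1 ≤ k' q := by exact_mod_cast (by omega : k q + 1 ≤ k' q)
    have h3 := heq q
    have h4 := simplex_le hws q
    have h5 := simplex_le hws' q
    exact D.corner_ne' F hw hw' (by linarith : w q = 1) (by linarith : w' q = 1) rfl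
  have hg := grid_up (D.sub _ hc)
  have hg' := grid_down (D.sub _ hd)
  -- All differences `k q - k' q` are `0` or `1`, and they add up to `1`.
  have : ∃ p, k p = k' p + 1 ∧ ∀ q, q ≠ p → k q = k' q := by
    have a0 := hle 0
    have a1 := hle 1
    have a2 := hle 2
    have b0 := hge 0
    have b1 := hge 1
    have b2 := hge 2
    rcases (by omega : k 0 = k' 0 + 1 ∨ k 1 = k' 1 + 1 ∨ k 2 = k' 2 + 1) with h | h | h
    · refine ⟨0, h, fun q hq => ?_⟩
      fin_cases q <;> simp at * <;> omega
    · refine ⟨1, h, fun q hq => ?_⟩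
      fin_cases q <;> simp at * <;> omega
    · refine ⟨2, h, fun q hq => ?_⟩
      fin_cases q <;> simp at * <;> omega
  obtain ⟨p, hp, hq⟩ := this
  have hp' : (k p : ℝ) = k' p + 1 := by exact_mod_cast hp
  have hq' : ∀ q, q ≠ p → w q + w' q = 1 := by
    intro q hqp
    have h2 := hq q hqp
    have h3 := heq q
    rw [h2] at h3
    linarith
  have hwp : w p = 0 := by linarith [heq p, hws.1 p, hws'.1 p]
  have hwp' : w' p = 0 := by linarith [heq p, hws.1 p, hws'.1 p]
  refine ⟨p, ⟨k, k', rfl, rfl, hp, hq⟩, D.eq_exitPoint F hw hw' hwp hwp' hq', ?_⟩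
  refine D.eq_exitPoint F hw' (z' := w) (by rwa [Bool.not_not]) hwp' hwp ?_
  intro q hqp
  rw [add_comm]; exact hq' q hqp

lemma exists_lt_of_sum_eq {k k' : Fin 3 → ℕ} (h : k 0 + k 1 + k 2 = k' 0 + k' 1 + k' 2)
    (hne : k ≠ k') : ∃ q, k' q < k q := by
  by_contra! hle
  apply hne
  funext q
  have a0 := hle 0
  have a1 := hle 1
  have a2 := hle 2
  fin_cases q <;> simp <;> omega

/-- Different cells of a pattern whose pieces meet are neighbours, and the pieces meet in the
exits only. -/
lemma piece_inter (D : LabyrinthData m pat ex) (F : FractalPair m pat K) {b : Bool} {c d : Cell}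
    (hc : c ∈ pat b) (hd : d ∈ pat b) (hcd : c ≠ d) {w w' : Fin 3 → ℝ} (hw : w ∈ K (c.kind b))
    (hw' : w' ∈ K (d.kind b)) (h : cellMap m c w = cellMap m d w') :
    ∃ p, (IsNeighbour p c d ∨ IsNeighbour p d c) ∧ w = exitPoint m ex (c.kind b) p ∧
      w' = exitPoint m ex (d.kind b) p := by
  have h1 := D.one_lt_cast
  have hm0 : (m : ℝ) ≠ 0 := by linarith
  have hws := F.sub_simplex _ hw
  have hws' := F.sub_simplex _ hw'
  cases c with
  | up k =>
    cases d with
    | up k' =>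
      exfalso
      have hg := grid_up (D.sub _ hc)
      have hg' := grid_up (D.sub _ hd)
      have hne : k ≠ k' := fun e => hcd (by rw [e])
      -- Two upright cells can meet only in vertices. One coordinate is larger in each of them, so
      -- the common point is seen as vertex `q` from one and vertex `r ≠ q` from the other, and the
      -- fractal would contain two vertices.
      obtain ⟨q, hq⟩ := exists_lt_of_sum_eq (by omega) hne
      obtain ⟨r, hr⟩ := exists_lt_of_sum_eq (k := k') (k' := k) (by omega) hne.symm
      have heq : ∀ q, (k q : ℝ) + w q = k' q + w' q := by
        intro q
        have := congrFun h q
        simp only [cellMap] at this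
        field_simp at this
        linarith
      have hq' : (k' q : ℝ) + 1 ≤ k q := by exact_mod_cast hq
      have hr' : (k r : ℝ) + 1 ≤ k' r := by exact_mod_cast hr
      have e1 : w' q = 1 := by linarith [heq q, hws.1 q, simplex_le hws' q]
      have e2 : w r = 1 := by linarith [heq r, hws'.1 r, simplex_le hws r]
      have := D.corner_eq F hw' hw e1 e2
      subst this
      omega
    | down k' =>
      obtain ⟨p, h2, h3⟩ := D.piece_inter_up_down F hc hd hw hw' h
      exact ⟨p, Or.inl h2, h3⟩
  | down k =>
    cases d with
    | up k' =>
      obtain ⟨p, h2, h3⟩ := D.piece_inter_up_down F hd hc hw' hw h.symm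
      exact ⟨p, Or.inr h2, h3.2, h3.1⟩
    | down k' =>
      exfalso
      have hg := grid_down (D.sub _ hc)
      have hg' := grid_down (D.sub _ hd)
      have hne : k ≠ k' := fun e => hcd (by rw [e])
      obtain ⟨q, hq⟩ := exists_lt_of_sum_eq (by omega) hne
      obtain ⟨r, hr⟩ := exists_lt_of_sum_eq (k := k') (k' := k) (by omega) hne.symm
      have heq : ∀ q, (k q : ℝ) - w q = k' q - w' q := by
        intro q
        have := congrFun h q
        simp only [cellMap] at this
        field_simp at this
        linarith
      have hq' : (k' q : ℝ) + 1 ≤ k q := by exact_mod_cast hq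
      have hr' : (k r : ℝ) + 1 ≤ k' r := by exact_mod_cast hr
      have e1 : w q = 1 := by linarith [heq q, hws'.1 q, simplex_le hws q]
      have e2 : w' r = 1 := by linarith [heq r, hws.1 r, simplex_le hws' r]
      have := D.corner_eq F hw hw' e1 e2
      subst this
      omega

lemma isNeighbour_unique {p q : Fin 3} {c d : Cell} (h : IsNeighbour p c d ∨ IsNeighbour p d c)
    (h' : IsNeighbour q c d ∨ IsNeighbour q d c) : p = q := by
  by_contra hpq
  rcases h with ⟨k, k', rfl, rfl, h1, h2⟩ | ⟨k, k', rfl, rfl, h1, h2⟩ <;>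
  rcases h' with ⟨l, l', e1, e2, h3, h4⟩ | ⟨l, l', e1, e2, h3, h4⟩ <;> cases e1 <;> cases e2 <;>
  · have := h4 p hpq
    omega

end LabyrinthData
end TriLaby
end

noncomputable section
namespace TriLaby

/-! ### Injective paths in tree-like unions of closed sets -/

open Set Filter Topology

/-- An excursion out of `U` must leave and return through `U ∩ U'` by connectedness; this set has at
most one point, which an injective path cannot use twice. -/
lemma mem_of_mem_endpoints {X : Type*} [TopologicalSpace X] {γ : ℝ → X} {s u v : ℝ} (hsu : s ≤ u)
    (huv : u ≤ v) (hc : ContinuousOn γ (Icc s v)) (hi : InjOn γ (Icc s v)) {U U' : Set X}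
    (hU : IsClosed U) (hU' : IsClosed U') (hcov : ∀ t ∈ Icc s v, γ t ∈ U ∪ U')
    (hsub : (U ∩ U').Subsingleton) (hs : γ s ∈ U) (hv : γ v ∈ U) : γ u ∈ U := by
  by_contra hu
  have hu' : γ u ∈ U' := (hcov u ⟨hsu, huv⟩).resolve_left hu
  have key : ∀ x y : ℝ, Icc x y ⊆ Icc s v → x ≤ y → (γ x ∈ U ∧ γ y ∈ U' ∨ γ x ∈ U' ∧ γ y ∈ U) →
      ∃ t ∈ Icc x y, γ t ∈ U ∩ U' := by
    intro x y hxy hle h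
    have hp : IsPreconnected (γ '' Icc x y) := isPreconnected_Icc.image γ (hc.mono hxy)
    have hx : γ x ∈ γ '' Icc x y := mem_image_of_mem _ (left_mem_Icc.2 hle)
    have hy : γ y ∈ γ '' Icc x y := mem_image_of_mem _ (right_mem_Icc.2 hle)
    have h1 := isPreconnected_closed_iff.1 hp U U' hU hU'
      (by rintro _ ⟨t, ht, rfl⟩; exact hcov t (hxy ht))
    obtain ⟨_, ⟨t, ht, rfl⟩, h3⟩ : (γ '' Icc x y ∩ (U ∩ U')).Nonempty := by
      rcases h with ⟨h2, h3⟩ | ⟨h2, h3⟩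
      · exact h1 ⟨_, hx, h2⟩ ⟨_, hy, h3⟩
      · exact h1 ⟨_, hy, h3⟩ ⟨_, hx, h2⟩
    exact ⟨t, ht, h3⟩
  obtain ⟨t₁, ht₁, h₁⟩ := key s u (Icc_subset_Icc_right huv) hsu (Or.inl ⟨hs, hu'⟩)
  obtain ⟨t₂, ht₂, h₂⟩ := key u v (Icc_subset_Icc_left hsu) huv (Or.inr ⟨hu', hv⟩)
  have h3 : t₁ = t₂ := hi (Icc_subset_Icc_right huv ht₁) (Icc_subset_Icc_left hsu ht₂)
    (hsub h₁ h₂)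
  have h4 : t₁ = u := le_antisymm ht₁.2 (h3 ▸ ht₂.1)
  exact hu (h4 ▸ h₁.1)

/-- A family of closed sets indexed by the vertices of an acyclic graph, which intersect only
for adjacent vertices and in at most one point. -/
structure TreeLike {V X : Type*} [TopologicalSpace X] (G : SimpleGraph V) (K : V → Set X) :
    Prop where
  acyclic : G.IsAcyclic
  closed : ∀ c, IsClosed (K c)
  adj : ∀ c d x, c ≠ d → x ∈ K c → x ∈ K d → G.Adj c d
  subsingleton : ∀ c d, c ≠ d → (K c ∩ K d).Subsingleton

/-- The vertices that can be reached from `q` by walks that avoid `c`. -/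
def branch {V : Type*} (G : SimpleGraph V) (q c : V) : Set V :=
  {e | ∃ w : G.Walk q e, c ∉ w.support}

lemma not_mem_branch {V : Type*} (G : SimpleGraph V) (q c : V) : c ∉ branch G q c :=
  fun ⟨w, hw⟩ => hw w.end_mem_support

lemma branch_adj {V : Type*} {G : SimpleGraph V} {q c e e' : V} (he : e ∈ branch G q c)
    (he' : e' ∉ branch G q c) (h : G.Adj e e') : e' = c := by
  by_contra hne
  obtain ⟨w, hw⟩ := he
  refine he' ⟨w.concat h, ?_⟩
  rw [SimpleGraph.Walk.support_concat]
  simp [hw, Ne.symm hne]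

/-- Two different neighbours of `c` in one branch would be joined both through `c` and by a path
avoiding `c`. -/
lemma branch_unique {V : Type*} {G : SimpleGraph V} (hG : G.IsAcyclic) {q c e e' : V}
    (he : e ∈ branch G q c) (he' : e' ∈ branch G q c) (h : G.Adj e c) (h' : G.Adj e' c) :
    e = e' := by
  classical
  by_contra hne
  obtain ⟨w, hw⟩ := he
  obtain ⟨w', hw'⟩ := he'
  let p : G.Walk e e' := w.reverse.append w'
  have hp : c ∉ p.support := by
    simp [p, SimpleGraph.Walk.mem_support_append_iff, hw, hw']
  let p₁ : G.Path e e' := p.toPath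
  have hp₁ : c ∉ (p₁ : G.Walk e e').support := fun hc => hp (p.support_toPath_subset_support hc)
  let p₂ : G.Path e e' := ⟨.cons h (.cons h'.symm .nil), by
    simp [SimpleGraph.Walk.cons_isPath_iff, h.ne, h'.ne.symm, hne]⟩
  have := (hG.subsingleton_path e e').elim p₁ p₂
  rw [this] at hp₁
  simp [p₂] at hp₁

/-! ### How an injective path runs through a tree-like family. -/

section
variable {V X : Type*} {G : SimpleGraph V} {K : V → Set X} {γ : ℝ → X} {a b : ℝ}

/-- A branch is connected to its complement only by a single edge ending in `c`, so the two unions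
share at most the point belonging to that edge. This is the separation that makes
`mem_of_mem_endpoints` applicable. -/
lemma TreeLike.branch_inter [TopologicalSpace X] (h : TreeLike G K) (q c : V) :
    ((⋃ e ∈ branch G q c, K e) ∩ ⋃ e ∈ (branch G q c)ᶜ, K e).Subsingleton ∧
      ((⋃ e ∈ branch G q c, K e) ∩ ⋃ e ∈ (branch G q c)ᶜ, K e) ⊆ K c := by
  have key : ∀ x ∈ ((⋃ e ∈ branch G q c, K e) ∩ ⋃ e ∈ (branch G q c)ᶜ, K e),
      ∃ e ∈ branch G q c, G.Adj e c ∧ x ∈ K e ∧ x ∈ K c := by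
    rintro x ⟨hx, hx'⟩
    simp only [mem_iUnion] at hx hx'
    obtain ⟨e, he, hxe⟩ := hx
    obtain ⟨e', he', hxe'⟩ := hx'
    have hne : e ≠ e' := fun heq => he' (heq ▸ he)
    have hadj := h.adj e e' x hne hxe hxe'
    obtain rfl := branch_adj he he' hadj
    exact ⟨e, he, hadj, hxe, hxe'⟩
  refine ⟨fun x hx y hy => ?_, fun x hx => ?_⟩
  · obtain ⟨e, he, hadj, h1, h2⟩ := key x hx
    obtain ⟨e', he', hadj', h1', h2'⟩ := key y hy
    obtain rfl := branch_unique h.acyclic he he' hadj hadj'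
    exact h.subsingleton e c hadj.ne ⟨h1, h2⟩ ⟨h1', h2'⟩
  · obtain ⟨_, _, _, _, h2⟩ := key x hx
    exact h2

lemma TreeLike.closed_biUnion [Finite V] [TopologicalSpace X] (h : TreeLike G K) (S : Set V) : IsClosed (⋃ e ∈ S, K e) :=
  (Set.toFinite S).isClosed_biUnion fun e _ => h.closed e

lemma mem_union_compl (S : Set V) {x : X} (hx : ∃ c, x ∈ K c) :
    x ∈ (⋃ e ∈ S, K e) ∪ ⋃ e ∈ Sᶜ, K e := by
  obtain ⟨c, hc⟩ := hx
  by_cases hS : c ∈ S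
  · exact Or.inl (mem_biUnion hS hc)
  · exact Or.inr (mem_biUnion (show c ∈ Sᶜ from hS) hc)

/-- An injective path stays in `K c` between two visits. -/
lemma TreeLike.mem_of_between [Finite V] [TopologicalSpace X] (h : TreeLike G K) (hc : ContinuousOn γ (Icc a b))
    (hi : InjOn γ (Icc a b)) (hm : ∀ t ∈ Icc a b, ∃ c, γ t ∈ K c) {c : V} {s u v : ℝ}
    (hs : s ∈ Icc a b) (hv : v ∈ Icc a b) (hsu : s ≤ u) (huv : u ≤ v) (hsc : γ s ∈ K c)
    (hvc : γ v ∈ K c) : γ u ∈ K c := by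
  have hsub : Icc s v ⊆ Icc a b := Icc_subset_Icc hs.1 hv.2
  obtain ⟨d, hd⟩ := hm u (hsub ⟨hsu, huv⟩)
  by_cases hdc : c = d
  · exact hdc ▸ hd
  -- The path starts and ends outside the branch of `d`, hence stays in the union of the outside
  -- cells; but `γ u` also lies in the branch, and the two sides meet only inside `K c`.
  have hB := h.branch_inter d c
  have hdB : d ∈ branch G d c := ⟨.nil, by simpa using hdc⟩
  have hcB : c ∈ (branch G d c)ᶜ := not_mem_branch G d c
  have h2 := mem_of_mem_endpoints hsu huv (hc.mono hsub) (hi.mono hsub)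
    (h.closed_biUnion (branch G d c)ᶜ) (h.closed_biUnion (branch G d c))
    (fun t ht => (mem_union_compl (branch G d c) (hm t (hsub ht))).symm)
    (by rw [inter_comm]; exact hB.1) (mem_biUnion hcB hsc) (mem_biUnion hcB hvc)
  exact hB.2 ⟨mem_biUnion hdB hd, h2⟩

/-- An injective path visits (in more than one point) only cells on any walk that joins the
cells of its endpoints. -/
lemma TreeLike.mem_support [Finite V] [TopologicalSpace X] (h : TreeLike G K) (hc : ContinuousOn γ (Icc a b))
    (hi : InjOn γ (Icc a b)) (hm : ∀ t ∈ Icc a b, ∃ c, γ t ∈ K c) {c q q' : V} {s t : ℝ}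
    (hs : s ∈ Icc a b) (ht : t ∈ Icc a b) (hst : s < t) (hsc : γ s ∈ K c) (htc : γ t ∈ K c)
    (hq : γ a ∈ K q) (hq' : γ b ∈ K q') (w : G.Walk q q') : c ∈ w.support := by
  by_contra hcw
  have hB := h.branch_inter q c
  have hqB : q ∈ branch G q c := ⟨.nil, fun hmem => by
    simp only [SimpleGraph.Walk.support_nil, List.mem_singleton] at hmem
    exact hcw (hmem ▸ w.start_mem_support)⟩
  have hqB' : q' ∈ branch G q c := ⟨w, hcw⟩
  have hcB : c ∈ (branch G q c)ᶜ := not_mem_branch G q c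
  -- Both ends lie in the branch of `q` that avoids `c`, so the whole path stays there and can meet
  -- `K c` at most once.
  have key : ∀ u ∈ Icc a b, γ u ∈ ⋃ e ∈ branch G q c, K e := fun u hu =>
    mem_of_mem_endpoints hu.1 hu.2 hc hi (h.closed_biUnion _)
      (h.closed_biUnion (branch G q c)ᶜ)
      (fun t ht => mem_union_compl (branch G q c) (hm t ht))
      hB.1 (mem_biUnion hqB hq) (mem_biUnion hqB' hq')
  have := hB.1 ⟨key s hs, mem_biUnion hcB hsc⟩ ⟨key t ht, mem_biUnion hcB htc⟩
  exact hst.ne (hi hs ht this)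

/-- Pigeonhole: one of the finitely many closed sets is visited at times accumulating at `u`, and
closedness adds the time `u` itself. -/
lemma TreeLike.exists_frequently [Finite V] [TopologicalSpace X] (h : TreeLike G K) (hc : ContinuousOn γ (Icc a b))
    (hm : ∀ t ∈ Icc a b, ∃ c, γ t ∈ K c) {u : ℝ} (hu : u ∈ Icc a b) {F : Filter ℝ} [F.NeBot]
    (hF : F ≤ 𝓝[Icc a b] u) : ∃ d, γ u ∈ K d ∧ ∃ᶠ v in F, γ v ∈ K d := by
  have h1 : ∀ᶠ v in F, v ∈ Icc a b := hF self_mem_nhdsWithin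
  have h2 : ∃ d, ∃ᶠ v in F, γ v ∈ K d := by
    by_contra! hno
    have := eventually_all.2 hno
    obtain ⟨v, hv, hv'⟩ := (h1.and this).exists
    obtain ⟨d, hd⟩ := hm v hv
    exact hv' d hd
  obtain ⟨d, hd⟩ := h2
  exact ⟨d, (h.closed d).mem_of_frequently_of_tendsto hd ((hc u hu).mono_left hF), hd⟩

/-- `c` is visited by the path exactly during the non-degenerate time interval `[s, t]`. -/
def VisitedDuring (γ : ℝ → X) (K : V → Set X) (a b : ℝ) (c : V) (s t : ℝ) : Prop :=
  a ≤ s ∧ s < t ∧ t ≤ b ∧ ∀ u ∈ Icc a b, γ u ∈ K c ↔ u ∈ Icc s t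

lemma TreeLike.exists_visited [Finite V] [TopologicalSpace X] (h : TreeLike G K) (hc : ContinuousOn γ (Icc a b))
    (hi : InjOn γ (Icc a b)) (hm : ∀ t ∈ Icc a b, ∃ c, γ t ∈ K c) {c : V} {u v : ℝ}
    (hu : u ∈ Icc a b) (hv : v ∈ Icc a b) (huv : u ≠ v) (huc : γ u ∈ K c) (hvc : γ v ∈ K c) :
    ∃ s t, VisitedDuring γ K a b c s t := by
  have hcl : IsClosed (Icc a b ∩ γ ⁻¹' K c) := hc.preimage_isClosed_of_isClosed isClosed_Icc (h.closed c)
  have hcomp : IsCompact (Icc a b ∩ γ ⁻¹' K c) := isCompact_Icc.of_isClosed_subset hcl inter_subset_left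
  obtain ⟨s, hs, hs'⟩ := hcomp.exists_isLeast ⟨u, hu, huc⟩
  obtain ⟨t, ht, ht'⟩ := hcomp.exists_isGreatest ⟨u, hu, huc⟩
  refine ⟨s, t, hs.1.1, ?_, ht.1.2, fun x hx => ⟨fun hxc => ⟨hs' ⟨hx, hxc⟩, ht' ⟨hx, hxc⟩⟩,
    fun hxst => h.mem_of_between hc hi hm hs.1 ht.1 hxst.1 hxst.2 hs.2 ht.2⟩⟩
  rcases lt_or_gt_of_ne huv with h1 | h1
  · exact (hs' ⟨hu, huc⟩).trans_lt (h1.trans_le (ht' ⟨hv, hvc⟩))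
  · exact (hs' ⟨hv, hvc⟩).trans_lt (h1.trans_le (ht' ⟨hu, huc⟩))

/-- A set found by accumulation contains the path at a second time as well, so the visit is
non-degenerate. Times approach `u` from the left, except at the initial time, where only the right
is available. -/
lemma TreeLike.exists_visited_mem [Finite V] [TopologicalSpace X] (h : TreeLike G K) (hab : a < b) (hc : ContinuousOn γ (Icc a b))
    (hi : InjOn γ (Icc a b)) (hm : ∀ t ∈ Icc a b, ∃ c, γ t ∈ K c) {u : ℝ} (hu : u ∈ Icc a b) :
    ∃ c s t, VisitedDuring γ K a b c s t ∧ u ∈ Icc s t := by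
  have key : ∀ F : Filter ℝ, F.NeBot → F ≤ 𝓝[Icc a b] u → (∀ᶠ v in F, v ≠ u) →
      ∃ c s t, VisitedDuring γ K a b c s t ∧ u ∈ Icc s t := by
    intro F hF hle hne
    obtain ⟨d, hd, hfr⟩ := h.exists_frequently hc hm hu hle
    obtain ⟨v, hv, hvu, hvab⟩ := (hfr.and_eventually (hne.and (hle self_mem_nhdsWithin))).exists
    obtain ⟨s, t, hst⟩ := h.exists_visited hc hi hm hu hvab hvu.symm hd hv
    exact ⟨d, s, t, hst, (hst.2.2.2 u hu).1 hd⟩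
  rcases hu.1.eq_or_lt with rfl | hau
  · refine key (𝓝[Ioc a b] a) ?_ (nhdsWithin_mono _ Ioc_subset_Icc_self) ?_
    · rw [nhdsWithin_Ioc_eq_nhdsGT hab]; infer_instance
    · filter_upwards [self_mem_nhdsWithin] with v hv using hv.1.ne'
  · refine key (𝓝[Ico a u] u) ?_
      (nhdsWithin_mono _ (Ico_subset_Icc_self.trans (Icc_subset_Icc_right hu.2))) ?_
    · rw [nhdsWithin_Ico_eq_nhdsLT hau]; infer_instance
    · filter_upwards [self_mem_nhdsWithin] with v hv using hv.2.ne

/-- At the beginning of a visit, the path comes from another visited cell. -/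
lemma TreeLike.exists_prev [Finite V] [TopologicalSpace X] (h : TreeLike G K) (hc : ContinuousOn γ (Icc a b))
    (hi : InjOn γ (Icc a b)) (hm : ∀ t ∈ Icc a b, ∃ c, γ t ∈ K c) {c : V} {s t : ℝ}
    (hv : VisitedDuring γ K a b c s t) (has : a < s) :
    ∃ d s' t', d ≠ c ∧ VisitedDuring γ K a b d s' t' ∧ γ s ∈ K d := by
  have hsb : s ≤ b := hv.2.1.le.trans hv.2.2.1
  have hle : 𝓝[Ico a s] s ≤ 𝓝[Icc a b] s :=
    nhdsWithin_mono _ (Ico_subset_Icc_self.trans (Icc_subset_Icc_right hsb))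
  have : (𝓝[Ico a s] s).NeBot := by
    rw [nhdsWithin_Ico_eq_nhdsLT has]; infer_instance
  obtain ⟨d, hd, hfr⟩ := h.exists_frequently hc hm ⟨has.le, hsb⟩ hle
  obtain ⟨v, hvd, hvI⟩ := (hfr.and_eventually self_mem_nhdsWithin).exists
  have hvab : v ∈ Icc a b := ⟨hvI.1, hvI.2.le.trans hsb⟩
  obtain ⟨s', t', h'⟩ := h.exists_visited hc hi hm ⟨has.le, hsb⟩ hvab hvI.2.ne' hd hvd
  refine ⟨d, s', t', ?_, h', hd⟩
  rintro rfl
  exact absurd ((hv.2.2.2 v hvab).1 hvd).1 (not_le.2 hvI.2)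

/-- At the end of a visit, the path goes on to another visited cell. -/
lemma TreeLike.exists_next [Finite V] [TopologicalSpace X] (h : TreeLike G K) (hc : ContinuousOn γ (Icc a b))
    (hi : InjOn γ (Icc a b)) (hm : ∀ t ∈ Icc a b, ∃ c, γ t ∈ K c) {c : V} {s t : ℝ}
    (hv : VisitedDuring γ K a b c s t) (htb : t < b) :
    ∃ d s' t', d ≠ c ∧ VisitedDuring γ K a b d s' t' ∧ γ t ∈ K d := by
  have hat : a ≤ t := hv.1.trans hv.2.1.le
  have hle : 𝓝[Ioc t b] t ≤ 𝓝[Icc a b] t :=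
    nhdsWithin_mono _ (Ioc_subset_Icc_self.trans (Icc_subset_Icc_left hat))
  have : (𝓝[Ioc t b] t).NeBot := by
    rw [nhdsWithin_Ioc_eq_nhdsGT htb]; infer_instance
  obtain ⟨d, hd, hfr⟩ := h.exists_frequently hc hm ⟨hat, htb.le⟩ hle
  obtain ⟨v, hvd, hvI⟩ := (hfr.and_eventually self_mem_nhdsWithin).exists
  have hvab : v ∈ Icc a b := ⟨hat.trans hvI.1.le, hvI.2⟩
  obtain ⟨s', t', h'⟩ := h.exists_visited hc hi hm ⟨hat, htb.le⟩ hvab hvI.1.ne hd hvd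
  refine ⟨d, s', t', ?_, h', hd⟩
  rintro rfl
  exact absurd ((hv.2.2.2 v hvab).1 hvd).2 (not_le.2 hvI.1)

lemma VisitedDuring.left_mem {c : V} {s t : ℝ} (h : VisitedDuring γ K a b c s t) : γ s ∈ K c :=
  (h.2.2.2 s ⟨h.1, h.2.1.le.trans h.2.2.1⟩).2 (left_mem_Icc.2 h.2.1.le)

lemma VisitedDuring.right_mem {c : V} {s t : ℝ} (h : VisitedDuring γ K a b c s t) : γ t ∈ K c :=
  (h.2.2.2 t ⟨h.1.trans h.2.1.le, h.2.2.1⟩).2 (right_mem_Icc.2 h.2.1.le)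

lemma VisitedDuring.subset {c : V} {s t : ℝ} (h : VisitedDuring γ K a b c s t) :
    Icc s t ⊆ Icc a b := Icc_subset_Icc h.1 h.2.2.1

/-- Two cells that are both visited during non-trivial parts of an interval are equal. -/
lemma TreeLike.eq_of_visited [TopologicalSpace X] (h : TreeLike G K) (hi : InjOn γ (Icc a b)) {c d : V} {u v : ℝ}
    (hu : u ∈ Icc a b) (hv : v ∈ Icc a b) (huv : u ≠ v) (huc : γ u ∈ K c) (hvc : γ v ∈ K c)
    (hud : γ u ∈ K d) (hvd : γ v ∈ K d) : c = d := by
  by_contra hne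
  exact huv (hi hu hv (h.subsingleton c d hne ⟨huc, hud⟩ ⟨hvc, hvd⟩))

end
end TriLaby
end

noncomputable section
namespace TriLaby

/-! ### Paths between exits -/

open Set

/-- An injective path in `S`. -/
structure InjPath {X : Type*} [TopologicalSpace X] (S : Set X) (γ : ℝ → X) (s t : ℝ) : Prop where
  cont : ContinuousOn γ (Icc s t)
  inj : InjOn γ (Icc s t)
  maps : ∀ u ∈ Icc s t, γ u ∈ S

/-- The inverse of `cellMap`. -/
def cellInv (m : ℕ) : Cell → (Fin 3 → ℝ) → (Fin 3 → ℝ)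
  | .up k, z => fun r => m * z r - k r
  | .down k, z => fun r => k r + 1 - m * z r

lemma cellInv_cellMap {m : ℕ} (hm : 2 ≤ m) (c : Cell) (z : Fin 3 → ℝ) :
    cellInv m c (cellMap m c z) = z := by
  have hm' : (m : ℝ) ≠ 0 := by positivity
  funext r
  cases c <;> simp only [cellInv, cellMap] <;> field_simp <;> ring

lemma continuous_cellMap (m : ℕ) (c : Cell) : Continuous (cellMap m c) := by
  refine continuous_pi fun r => ?_
  cases c <;> simp only [cellMap] <;> fun_prop

lemma continuous_cellInv (m : ℕ) (c : Cell) : Continuous (cellInv m c) := by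
  refine continuous_pi fun r => ?_
  cases c <;> simp only [cellInv] <;> fun_prop

lemma grid_finite (m : ℕ) : (grid m).Finite := by
  have h := Set.finite_Icc (0 : Fin 3 → ℕ) (fun _ => m)
  refine ((h.image Cell.up).union (h.image Cell.down)).subset ?_
  rintro c (⟨k, rfl, hk⟩ | ⟨k, rfl, hk⟩)
  · refine Or.inl ⟨k, ⟨fun _ => Nat.zero_le _, fun q => ?_⟩, rfl⟩
    fin_cases q <;> simp <;> omega
  · refine Or.inr ⟨k, ⟨fun _ => Nat.zero_le _, fun q => ?_⟩, rfl⟩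
    fin_cases q <;> simp <;> omega

/-- The part of the fractal inside a cell of its pattern. -/
def piece (m : ℕ) (pat : Bool → Set Cell) (K : Bool → Set (Fin 3 → ℝ)) (b : Bool) (c : pat b) :
    Set (Fin 3 → ℝ) :=
  cellMap m c.1 '' K (c.1.kind b)

lemma IsNeighbour.ne {p : Fin 3} {c d : Cell} (h : IsNeighbour p c d ∨ IsNeighbour p d c) :
    c ≠ d := by
  rcases h with ⟨k, k', rfl, rfl, h⟩ | ⟨k, k', rfl, rfl, h⟩ <;> simp

lemma IsNeighbour.coord_ne {p : Fin 3} {c d : Cell} (h : IsNeighbour p c d ∨ IsNeighbour p d c) :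
    c.coord p ≠ d.coord p := by
  rcases h with ⟨k, k', rfl, rfl, h, -⟩ | ⟨k, k', rfl, rfl, h, -⟩ <;> simp [Cell.coord, h]

lemma IsNeighbour.coord_eq {p q : Fin 3} {c d : Cell} (h : IsNeighbour p c d ∨ IsNeighbour p d c)
    (hq : q ≠ p) : c.coord q = d.coord q := by
  rcases h with ⟨k, k', rfl, rfl, -, h⟩ | ⟨k, k', rfl, rfl, -, h⟩ <;> simp [Cell.coord, h q hq]

lemma IsNeighbour.adj {pat : Set Cell} {p : Fin 3} {c d : pat}
    (h : IsNeighbour p c.1 d.1 ∨ IsNeighbour p d.1 c.1) : (cellGraph.induce pat).Adj c d := by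
  rw [SimpleGraph.comap_adj]
  refine (SimpleGraph.fromRel_adj _ _ _).2 ⟨IsNeighbour.ne h, ?_⟩
  exact h.imp (fun h => ⟨p, h⟩) fun h => ⟨p, h⟩

namespace LabyrinthData

variable {m : ℕ} {pat : Bool → Set Cell} {ex : Bool → Fin 3 → Fin 3 → ℕ}
  {K : Bool → Set (Fin 3 → ℝ)}

lemma finite (D : LabyrinthData m pat ex) (b : Bool) : Finite (pat b) :=
  ((grid_finite m).subset (D.sub b)).to_subtype

lemma treeLike (D : LabyrinthData m pat ex) (F : FractalPair m pat K) (b : Bool) :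
    TreeLike (cellGraph.induce (pat b)) (piece m pat K b) where
  acyclic := D.acyclic b
  closed c := by
    have hc : IsCompact (K (c.1.kind b)) :=
      (isCompact_stdSimplex ℝ (Fin 3)).of_isClosed_subset (F.closed _) (F.sub_simplex _)
    exact (hc.image (continuous_cellMap m c.1)).isClosed
  adj c d x hcd hx hx' := by
    obtain ⟨w, hw, rfl⟩ := hx
    obtain ⟨w', hw', h⟩ := hx'
    obtain ⟨p, hp, -⟩ := D.piece_inter F c.2 d.2 (fun e => hcd (Subtype.ext e)) hw hw' h.symm
    exact IsNeighbour.adj hp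
  subsingleton c d hcd := by
    have hcd' : c.1 ≠ d.1 := fun e => hcd (Subtype.ext e)
    rintro _ ⟨⟨w, hw, rfl⟩, w', hw', h⟩ _ ⟨⟨z, hz, rfl⟩, z', hz', h'⟩
    obtain ⟨p, hp, hwp, -⟩ := D.piece_inter F c.2 d.2 hcd' hw hw' h.symm
    obtain ⟨q, hq, hzq, -⟩ := D.piece_inter F c.2 d.2 hcd' hz hz' h'.symm
    rw [hwp, hzq, isNeighbour_unique hp hq]

lemma exists_piece (F : FractalPair m pat K) {b : Bool} {x : Fin 3 → ℝ} (hx : x ∈ K b) :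
    ∃ c, x ∈ piece m pat K b c := by
  obtain ⟨c, hc, w, hw, rfl⟩ := F.cover b x hx
  exact ⟨⟨c, hc⟩, w, hw, rfl⟩

variable {b : Bool} {γ : ℝ → Fin 3 → ℝ} {s₀ t₀ : ℝ}

lemma cellMap_cellInv_of_mem (D : LabyrinthData m pat ex) {c : pat b} {x : Fin 3 → ℝ}
    (hx : x ∈ piece m pat K b c) : cellInv m c.1 x ∈ K (c.1.kind b) ∧
      cellMap m c.1 (cellInv m c.1 x) = x := by
  obtain ⟨w, hw, rfl⟩ := hx
  rw [cellInv_cellMap D.two_le]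
  exact ⟨hw, rfl⟩

lemma subPath (D : LabyrinthData m pat ex) (hγ : InjPath (K b) γ s₀ t₀) {c : pat b} {s t : ℝ}
    (hv : VisitedDuring γ (piece m pat K b) s₀ t₀ c s t) :
    InjPath (K (c.1.kind b)) (fun u => cellInv m c.1 (γ u)) s t ∧
      ∀ u ∈ Icc s t, cellMap m c.1 (cellInv m c.1 (γ u)) = γ u := by
  have h1 : ∀ u ∈ Icc s t, γ u ∈ piece m pat K b c := fun u hu =>
    (hv.2.2.2 u (hv.subset hu)).2 hu
  have h2 : ∀ u ∈ Icc s t, cellMap m c.1 (cellInv m c.1 (γ u)) = γ u := fun u hu =>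
    (D.cellMap_cellInv_of_mem (h1 u hu)).2
  refine ⟨⟨(continuous_cellInv m c.1).comp_continuousOn (hγ.cont.mono hv.subset), ?_, ?_⟩, h2⟩
  · intro u hu v hv' huv
    apply hγ.inj (hv.subset hu) (hv.subset hv')
    rw [← h2 u hu, ← h2 v hv']
    exact congrArg _ huv
  · exact fun u hu => (D.cellMap_cellInv_of_mem (h1 u hu)).1

lemma exit_of_mem (D : LabyrinthData m pat ex) (F : FractalPair m pat K) {c d : pat b}
    (hcd : d ≠ c) {x : Fin 3 → ℝ} (hc : x ∈ piece m pat K b c) (hd : x ∈ piece m pat K b d) :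
    ∃ p, (IsNeighbour p c.1 d.1 ∨ IsNeighbour p d.1 c.1) ∧
      cellInv m c.1 x = exitPoint m ex (c.1.kind b) p := by
  obtain ⟨w, hw, rfl⟩ := hc
  obtain ⟨w', hw', h⟩ := hd
  obtain ⟨p, hp, hwp, -⟩ := D.piece_inter F c.2 d.2 (fun e => hcd (Subtype.ext e.symm)) hw hw'
    h.symm
  exact ⟨p, hp, by rw [cellInv_cellMap D.two_le]; exact hwp⟩

/-- The visit of `c` begins (or ends) in the exit of type `p`, which is either the exit of type
`p₀` of the big triangle or shared with another visited cell. -/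
def PassesExit (_D : LabyrinthData m pat ex) (K : Bool → Set (Fin 3 → ℝ)) (b : Bool)
    (γ : ℝ → Fin 3 → ℝ) (s₀ t₀ : ℝ) (c : pat b) (p₀ p : Fin 3) : Prop :=
  (c.1 = .up (ex b p₀) ∧ p = p₀) ∨ ∃ d s t, VisitedDuring γ (piece m pat K b) s₀ t₀ d s t ∧
    (IsNeighbour p c.1 d.1 ∨ IsNeighbour p d.1 c.1)

/-- All exits of type different from `r`, where `r ≠ l`, are joined inside a strip of type `r`. -/
def StraightAlong (D : LabyrinthData m pat ex) (l : Fin 3) : Prop :=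
  ∀ b r, r ≠ l → ∀ p q, p ≠ r → q ≠ r → p ≠ q →
    ∃ w : (cellGraph.induce (pat b)).Walk ⟨.up (ex b p), D.ex_mem b p⟩ ⟨.up (ex b q), D.ex_mem b q⟩,
      ∀ c ∈ w.support, c.1.coord r = ex b p r

/-! ### Consequences of straightness for the exits and the paths between them. -/

section Straight

variable {D : LabyrinthData m pat ex} {l : Fin 3}

/-- Since `l ≠ r`, the exit of type `l` is joined to that of type `p` inside one strip of type `r`.
Thus all exits on the line of type `r` can be referred to the exit `l`. -/
lemma StraightAlong.ex_eq (h : D.StraightAlong l) (b : Bool) {p r : Fin 3} (hr : r ≠ l)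
    (hp : p ≠ r) : ex b p r = ex b l r := by
  rcases eq_or_ne p l with rfl | hpl
  · rfl
  · obtain ⟨w, hw⟩ := h b r hr p l hp hr.symm hpl
    exact (hw _ w.end_mem_support).symm

lemma ex_sum (D : LabyrinthData m pat ex) (b : Bool) {p q r : Fin 3} (hpq : p ≠ q) (hpr : p ≠ r)
    (hqr : q ≠ r) : ex b p q + ex b p r + 1 = m := by
  have h1 := grid_up (D.sub b (D.ex_mem b p))
  rw [sum_three _ hpq hpr hqr, D.ex_self] at h1
  omega

/-- If the exit of type `l` had coordinate `r` equal to zero, it would be a corner cell, and by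
`StraightAlong.ex_eq` the exit of the third type would be a corner cell at a different vertex. -/
lemma StraightAlong.ex_pos (h : D.StraightAlong l) (b : Bool) {p q : Fin 3} (hpq : p ≠ q) :
    0 < ex b p q := by
  have key : ∀ r, r ≠ l → 0 < ex b l r := by
    intro r hr
    by_contra h0
    obtain ⟨r', hr', hrl⟩ := exists_other r l
    have h1 := D.ex_sum b hr.symm hrl.symm hr'.symm
    have h2 := D.ex_sum b hr' hrl hr
    rw [h.ex_eq b hr hr'] at h2
    exact hrl (D.corner_unique b _ _ r' l (D.ex_mem b l) (D.ex_mem b r') (by omega) (by omega))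
  rcases eq_or_ne p l with rfl | hp
  · exact key q hpq.symm
  rcases eq_or_ne q l with rfl | hq
  · obtain ⟨r, hr, hrl⟩ := exists_other p q
    have h1 := D.ex_sum b hpq hr.symm hrl.symm
    have h2 := D.ex_sum b hpq.symm hrl.symm hr.symm
    have h3 := h.ex_eq b hrl hr.symm
    have := key p hp
    omega
  · rw [h.ex_eq b hq hpq]
    exact key q hq

lemma StraightAlong.three_le (h : D.StraightAlong l) : 3 ≤ m := by
  have h1 := D.ex_sum true (p := 0) (q := 1) (r := 2) (by decide) (by decide) (by decide)
  have h2 := h.ex_pos true (p := 0) (q := 1) (by decide)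
  have h3 := h.ex_pos true (p := 0) (q := 2) (by decide)
  omega

lemma StraightAlong.exitPoint_injective (h : D.StraightAlong l) {p q : Fin 3}
    (hpq : exitPoint m ex b p = exitPoint m ex b q) : p = q := by
  by_contra hne
  have h1 := D.one_lt_cast
  have h2 := congrFun hpq p
  simp only [exitPoint, D.ex_self] at h2
  have h3 : (0 : ℝ) < ex b q p := by exact_mod_cast h.ex_pos b (Ne.symm hne)
  have h4 : (0 : ℝ) < ex b q p / ((m : ℝ) - 1) := div_pos h3 (by linarith)
  rw [← h2] at h4
  simp at h4

/-- If a second piece contained the exit point, the exit cell would have a neighbour across side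
`p`, but that side lies on the boundary of the big triangle. -/
lemma StraightAlong.exitPoint_mem_piece (F : FractalPair m pat K) (h : D.StraightAlong l)
    {p : Fin 3} (hp : exitPoint m ex b p ∈ K b) {c : pat b} :
    exitPoint m ex b p ∈ piece m pat K b c ↔ c.1 = .up (ex b p) := by
  constructor
  · intro hc
    by_contra hne
    obtain ⟨q, hq, h2⟩ := D.exit_of_mem F (c := ⟨.up (ex b p), D.ex_mem b p⟩) (d := c)
      (fun e => hne (by rw [e])) ⟨_, hp, D.exitPoint_fixed b p⟩ hc
    have h3 : exitPoint m ex b p = exitPoint m ex b q := by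
      rw [← cellInv_cellMap D.two_le (.up (ex b p)) (exitPoint m ex b p), D.exitPoint_fixed]
      exact h2
    obtain rfl := h.exitPoint_injective h3
    rcases hq with ⟨k, k', e1, e2, h4, -⟩ | ⟨k, k', e1, e2, h4, -⟩
    · cases e1
      rw [D.ex_self] at h4
      omega
    · cases e2
  · rintro hc
    refine ⟨exitPoint m ex b p, ?_, ?_⟩
    · rw [hc]; exact hp
    · rw [hc]; exact D.exitPoint_fixed b p

lemma StraightAlong.passes_left (F : FractalPair m pat K) (h : D.StraightAlong l)
    (hγ : InjPath (K b) γ s₀ t₀) {p₀ : Fin 3} (hp : γ s₀ = exitPoint m ex b p₀)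
    {c : pat b} {s t : ℝ} (hv : VisitedDuring γ (piece m pat K b) s₀ t₀ c s t) :
    ∃ p, D.PassesExit K b γ s₀ t₀ c p₀ p ∧
      cellInv m c.1 (γ s) = exitPoint m ex (c.1.kind b) p := by
  have := D.finite b
  rcases hv.1.eq_or_lt with rfl | hs
  · have h1 := hv.left_mem
    rw [hp, h.exitPoint_mem_piece F] at h1
    · refine ⟨p₀, Or.inl ⟨h1, rfl⟩, ?_⟩
      rw [h1, hp]
      have := cellInv_cellMap D.two_le (.up (ex b p₀)) (exitPoint m ex b p₀)
      rwa [D.exitPoint_fixed] at this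
    · rw [← hp]
      exact hγ.maps _ (left_mem_Icc.2 (hv.2.1.le.trans hv.2.2.1))
  · obtain ⟨d, s', t', hdc, hd, hsd⟩ := (D.treeLike F b).exists_prev hγ.cont hγ.inj
      (fun u hu => exists_piece F (hγ.maps u hu)) hv hs
    obtain ⟨p, hp1, hp2⟩ := D.exit_of_mem F hdc hv.left_mem hsd
    exact ⟨p, Or.inr ⟨d, s', t', hd, hp1⟩, hp2⟩

lemma StraightAlong.passes_right (F : FractalPair m pat K) (h : D.StraightAlong l)
    (hγ : InjPath (K b) γ s₀ t₀) {p₀ : Fin 3} (hp : γ t₀ = exitPoint m ex b p₀)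
    {c : pat b} {s t : ℝ} (hv : VisitedDuring γ (piece m pat K b) s₀ t₀ c s t) :
    ∃ p, D.PassesExit K b γ s₀ t₀ c p₀ p ∧
      cellInv m c.1 (γ t) = exitPoint m ex (c.1.kind b) p := by
  have := D.finite b
  rcases hv.2.2.1.eq_or_lt with rfl | hs
  · have h1 := hv.right_mem
    rw [hp, h.exitPoint_mem_piece F] at h1
    · refine ⟨p₀, Or.inl ⟨h1, rfl⟩, ?_⟩
      rw [h1, hp]
      have := cellInv_cellMap D.two_le (.up (ex b p₀)) (exitPoint m ex b p₀)
      rwa [D.exitPoint_fixed] at this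
    · rw [← hp]
      exact hγ.maps _ (right_mem_Icc.2 (hv.1.trans hv.2.1.le))
  · obtain ⟨d, s', t', hdc, hd, hsd⟩ := (D.treeLike F b).exists_next hγ.cont hγ.inj
      (fun u hu => exists_piece F (hγ.maps u hu)) hv hs
    obtain ⟨p, hp1, hp2⟩ := D.exit_of_mem F hdc hv.right_mem hsd
    exact ⟨p, Or.inr ⟨d, s', t', hd, hp1⟩, hp2⟩

lemma StraightAlong.visited_mem_support (F : FractalPair m pat K) (h : D.StraightAlong l)
    (hγ : InjPath (K b) γ s₀ t₀) {p₀ q₀ : Fin 3} (hst : s₀ < t₀)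
    (hp : γ s₀ = exitPoint m ex b p₀) (hq : γ t₀ = exitPoint m ex b q₀)
    {c : pat b} {s t : ℝ} (hv : VisitedDuring γ (piece m pat K b) s₀ t₀ c s t)
    (w : (cellGraph.induce (pat b)).Walk ⟨.up (ex b p₀), D.ex_mem b p₀⟩
      ⟨.up (ex b q₀), D.ex_mem b q₀⟩) : c ∈ w.support := by
  have := D.finite b
  have h1 := hγ.maps _ (left_mem_Icc.2 hst.le)
  have h2 := hγ.maps _ (right_mem_Icc.2 hst.le)
  refine (D.treeLike F b).mem_support hγ.cont hγ.inj
    (fun u hu => exists_piece F (hγ.maps u hu)) (hv.subset (left_mem_Icc.2 hv.2.1.le))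
    (hv.subset (right_mem_Icc.2 hv.2.1.le)) hv.2.1 hv.left_mem hv.right_mem ?_ ?_ w
  · rw [hp] at h1 ⊢
    exact (h.exitPoint_mem_piece F h1).2 rfl
  · rw [hq] at h2 ⊢
    exact (h.exitPoint_mem_piece F h2).2 rfl

/-- The engine of all contraction arguments: a cell in the right strip maps the line of its own
colour onto the line of the big triangle. For upside down cells this uses that the exits of the two
colours are mirror images. -/
lemma abs_cellMap_sub_exitPoint (D : LabyrinthData m pat ex) (b : Bool) {r : Fin 3} (hr : r ≠ l)
    {c : Cell} (hc : c.coord r = ex b l r) (z : Fin 3 → ℝ) :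
    |cellMap m c z r - exitPoint m ex b l r| =
      |z r - exitPoint m ex (c.kind b) l r| / m := by
  have h1 := D.one_lt_cast
  have h2 := congrFun (D.exitPoint_fixed b l) r
  simp only [cellMap] at h2
  cases c with
  | up k =>
    simp only [Cell.coord] at hc
    rw [← Nat.abs_cast m, ← abs_div]
    nth_rewrite 1 [← h2]
    simp only [cellMap, Cell.kind, hc]
    congr 1
    ring
  | down k =>
    simp only [Cell.coord] at hc
    have h3 : exitPoint m ex (!b) l r = 1 - exitPoint m ex b l r := by
      have h4 : (ex b l r : ℝ) + ex (!b) l r + 1 = m := by exact_mod_cast D.ex_mirror b l r hr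
      have : (m : ℝ) - 1 ≠ 0 := by linarith
      simp only [exitPoint]
      field_simp
      linarith
    rw [← Nat.abs_cast m, ← abs_div, ← abs_neg]
    nth_rewrite 1 [← h2]
    simp only [cellMap, Cell.kind, hc, h3]
    congr 1
    ring

lemma cellMap_eq_exitPoint (D : LabyrinthData m pat ex) (b : Bool) {r : Fin 3} (hr : r ≠ l)
    {c : Cell} (hc : c.coord r = ex b l r) {z : Fin 3 → ℝ}
    (hz : z r = exitPoint m ex (c.kind b) l r) : cellMap m c z r = exitPoint m ex b l r := by
  have := D.abs_cellMap_sub_exitPoint b hr hc z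
  rw [hz, sub_self, abs_zero, zero_div, abs_eq_zero, sub_eq_zero] at this
  exact this

/-- An injective path between two exits that are joined inside a strip is straight. -/
lemma StraightAlong.path_eq (F : FractalPair m pat K) (h : D.StraightAlong l) {r : Fin 3}
    (hr : r ≠ l) (hγ : InjPath (K b) γ s₀ t₀) (hst : s₀ < t₀) {p₀ q₀ : Fin 3} (hp₀ : p₀ ≠ r)
    (hq₀ : q₀ ≠ r) (hp : γ s₀ = exitPoint m ex b p₀) (hq : γ t₀ = exitPoint m ex b q₀) {u : ℝ}
    (hu : u ∈ Icc s₀ t₀) : γ u r = exitPoint m ex b l r := by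
  -- Colour, path and end types vary in the induction, since the part of the path in a cell is
  -- rescaled to a path in the fractal of that cell's colour.
  have key : ∀ n : ℕ, ∀ (b : Bool) (γ : ℝ → Fin 3 → ℝ) (s₀ t₀ : ℝ) (p₀ q₀ : Fin 3),
      InjPath (K b) γ s₀ t₀ → s₀ < t₀ → p₀ ≠ r → q₀ ≠ r → γ s₀ = exitPoint m ex b p₀ →
      γ t₀ = exitPoint m ex b q₀ → ∀ u ∈ Icc s₀ t₀,
      |γ u r - exitPoint m ex b l r| ≤ (1 / (m : ℝ)) ^ n := by
    intro n
    induction n with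
    | zero =>
      intro b γ s₀ t₀ p₀ q₀ hγ hst hp₀ hq₀ hp hq u hu
      have h2 := D.exitPoint_mem_Icc b l r
      have h3 := (F.sub_simplex _ (hγ.maps u hu)).1 r
      have h4 := simplex_le (F.sub_simplex _ (hγ.maps u hu)) r
      rw [pow_zero, abs_le]
      constructor <;> linarith [h2.1, h2.2]
    | succ n ih =>
      intro b γ s₀ t₀ p₀ q₀ hγ hst hp₀ hq₀ hp hq u hu
      have := D.finite b
      have hne : p₀ ≠ q₀ := by
        rintro rfl
        exact hst.ne (hγ.inj (left_mem_Icc.2 hst.le) (right_mem_Icc.2 hst.le) (hp.trans hq.symm))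
      obtain ⟨w, hw⟩ := h b r hr p₀ q₀ hp₀ hq₀ hne
      have hstrip : ∀ c s t, VisitedDuring γ (piece m pat K b) s₀ t₀ c s t →
          c.1.coord r = ex b l r := fun c s t hv => by
        rw [hw c (h.visited_mem_support F hγ hst hp hq hv w), h.ex_eq b hr hp₀]
      obtain ⟨c, s, t, hv, hust⟩ := (D.treeLike F b).exists_visited_mem hst hγ.cont hγ.inj
        (fun u hu => exists_piece F (hγ.maps u hu)) hu
      -- Passing a side of type `r` changes the coordinate `r`, that is, leaves the strip.
      have hpass : ∀ p₀ p, p₀ ≠ r → D.PassesExit K b γ s₀ t₀ c p₀ p → p ≠ r := by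
        rintro p₀ p hp₀ (⟨-, rfl⟩ | ⟨d, s', t', hd, hn⟩)
        · exact hp₀
        · rintro rfl
          exact IsNeighbour.coord_ne hn ((hstrip c s t hv).trans (hstrip d s' t' hd).symm)
      obtain ⟨p, hp1, hp2⟩ := h.passes_left F hγ hp hv
      obtain ⟨q, hq1, hq2⟩ := h.passes_right F hγ hq hv
      obtain ⟨hδ, hδ'⟩ := D.subPath hγ hv
      have h5 := ih (c.1.kind b) _ s t p q hδ hv.2.1 (hpass _ _ hp₀ hp1) (hpass _ _ hq₀ hq1) hp2
        hq2 u hust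
      rw [← hδ' u hust, D.abs_cellMap_sub_exitPoint b hr (hstrip c s t hv), pow_succ,
        div_eq_mul_one_div]
      gcongr
  exact sub_eq_zero.1 (eq_zero_of_abs_le_pow D.two_le fun n =>
    key n b γ s₀ t₀ p₀ q₀ hγ hst hp₀ hq₀ hp hq u hu)

/-- A neighbour across side `r` leaves strip `r` but keeps coordinate `r'`, so it would lie in
neither strip. The cell is not the exit cell of type `r` either, since that one has coordinate zero.
-/
lemma StraightAlong.type_ne (h : D.StraightAlong l) {r r' p₀ p : Fin 3} (hr : r ≠ l)
    (hrr : r ≠ r')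
    (hstrip : ∀ c s t, VisitedDuring γ (piece m pat K b) s₀ t₀ c s t →
      c.1.coord r = ex b l r ∨ c.1.coord r' = ex b l r')
    {c : pat b} (hc : c.1.coord r = ex b l r) (hc' : c.1.coord r' ≠ ex b l r')
    (hpass : D.PassesExit K b γ s₀ t₀ c p₀ p) : p ≠ r := by
  rintro rfl
  rcases hpass with ⟨h1, rfl⟩ | ⟨d, s', t', hd, hn⟩
  · rw [h1, Cell.coord, D.ex_self] at hc
    exact (h.ex_pos b hr.symm).ne hc
  · rcases hstrip d s' t' hd with h1 | h1
    · exact IsNeighbour.coord_ne hn (hc.trans h1.symm)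
    · exact hc' ((IsNeighbour.coord_eq hn hrr.symm).trans h1)

/-- Every injective path between exits runs on two lines. -/
lemma StraightAlong.path_mem_lines (F : FractalPair m pat K) (h : D.StraightAlong l)
    (hγ : InjPath (K b) γ s₀ t₀) (hst : s₀ < t₀) {p₀ q₀ : Fin 3}
    (hp : γ s₀ = exitPoint m ex b p₀) (hq : γ t₀ = exitPoint m ex b q₀) {u : ℝ}
    (hu : u ∈ Icc s₀ t₀) : ∃ r, r ≠ l ∧ γ u r = exitPoint m ex b l r := by
  obtain ⟨r, r', hr, hr', hrr, hall⟩ := exists_others l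
  have h1 := D.one_lt_cast
  have key : ∀ n : ℕ, ∀ (b : Bool) (γ : ℝ → Fin 3 → ℝ) (s₀ t₀ : ℝ) (p₀ q₀ : Fin 3),
      InjPath (K b) γ s₀ t₀ → s₀ < t₀ → γ s₀ = exitPoint m ex b p₀ →
      γ t₀ = exitPoint m ex b q₀ → ∀ u ∈ Icc s₀ t₀,
      |γ u r - exitPoint m ex b l r| * |γ u r' - exitPoint m ex b l r'| ≤ (1 / (m : ℝ)) ^ n := by
    intro n
    induction n with
    | zero =>
      intro b γ s₀ t₀ p₀ q₀ hγ hst hp hq u hu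
      have h5 : ∀ r, |γ u r - exitPoint m ex b l r| ≤ 1 := by
        intro r
        have h2 := D.exitPoint_mem_Icc b l r
        have h3 := (F.sub_simplex _ (hγ.maps u hu)).1 r
        have h4 := simplex_le (F.sub_simplex _ (hγ.maps u hu)) r
        rw [abs_le]
        constructor <;> linarith [h2.1, h2.2]
      rw [pow_zero]
      exact mul_le_one₀ (h5 r) (abs_nonneg _) (h5 r')
    | succ n ih =>
      intro b γ s₀ t₀ p₀ q₀ hγ hst hp hq u hu
      have := D.finite b
      have hne : p₀ ≠ q₀ := by
        rintro rfl
        exact hst.ne (hγ.inj (left_mem_Icc.2 hst.le) (right_mem_Icc.2 hst.le) (hp.trans hq.symm))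
      have straight : ∀ r, r ≠ l → p₀ ≠ r → q₀ ≠ r → |γ u r - exitPoint m ex b l r| = 0 := by
        intro r hr hpr hqr
        rw [h.path_eq F hr hγ hst hpr hqr hp hq hu, sub_self, abs_zero]
      have hpos : (0 : ℝ) ≤ (1 / (m : ℝ)) ^ (n + 1) := by positivity
      by_cases c1 : p₀ ≠ r ∧ q₀ ≠ r
      · rwa [straight r hr c1.1 c1.2, zero_mul]
      by_cases c2 : p₀ ≠ r' ∧ q₀ ≠ r'
      · rwa [straight r' hr' c2.1 c2.2, mul_zero]
      have hends : (p₀ = r' ∧ q₀ = r) ∨ (p₀ = r ∧ q₀ = r') := by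
        by_cases e1 : p₀ = r
        · subst e1
          exact Or.inr ⟨rfl, by by_contra e; exact c2 ⟨hrr, e⟩⟩
        · have e2 : q₀ = r := by by_contra e; exact c1 ⟨e1, e⟩
          subst e2
          exact Or.inl ⟨by by_contra e; exact c2 ⟨e, hrr⟩, rfl⟩
      have hp₀l : p₀ ≠ l := by rcases hends with ⟨rfl, -⟩ | ⟨rfl, -⟩ <;> assumption
      have hq₀l : q₀ ≠ l := by rcases hends with ⟨-, rfl⟩ | ⟨-, rfl⟩ <;> assumption
      -- The detour through the exit of type `l` need not be a path: visited cells lie on every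
      -- walk. Its first half stays in the strip of type `q₀`, its second half in that of type `p₀`.
      obtain ⟨w, hw⟩ := h b q₀ hq₀l p₀ l hne hq₀l.symm hp₀l
      obtain ⟨w', hw'⟩ := h b p₀ hp₀l l q₀ hp₀l.symm hne.symm hq₀l.symm
      have hstrip' : ∀ c s t, VisitedDuring γ (piece m pat K b) s₀ t₀ c s t →
          c.1.coord q₀ = ex b l q₀ ∨ c.1.coord p₀ = ex b l p₀ := by
        intro c s t hv
        have := h.visited_mem_support F hγ hst hp hq hv (w.append w')
        rw [SimpleGraph.Walk.mem_support_append_iff] at this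
        rcases this with h2 | h2
        · exact Or.inl ((hw c h2).trans (h.ex_eq b hq₀l hne))
        · exact Or.inr (hw' c h2)
      have hstrip : ∀ c s t, VisitedDuring γ (piece m pat K b) s₀ t₀ c s t →
          c.1.coord r = ex b l r ∨ c.1.coord r' = ex b l r' := by
        intro c s t hv
        rcases hends with ⟨rfl, rfl⟩ | ⟨rfl, rfl⟩
        · exact hstrip' c s t hv
        · exact (hstrip' c s t hv).symm
      obtain ⟨c, s, t, hv, hust⟩ := (D.treeLike F b).exists_visited_mem hst hγ.cont hγ.inj
        (fun u hu => exists_piece F (hγ.maps u hu)) hu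
      obtain ⟨p, hp1, hp2⟩ := h.passes_left F hγ hp hv
      obtain ⟨q, hq1, hq2⟩ := h.passes_right F hγ hq hv
      obtain ⟨hδ, hδ'⟩ := D.subPath hγ hv
      rw [← hδ' u hust]
      -- In a cell in both strips both factors shrink and the induction hypothesis applies. In a
      -- cell in only one strip the path is straight by `StraightAlong.path_eq`, and one factor
      -- vanishes.
      by_cases hcr : c.1.coord r = ex b l r
      · by_cases hcr' : c.1.coord r' = ex b l r'
        · have h5 := ih (c.1.kind b) _ s t p q hδ hv.2.1 hp2 hq2 u hust
          rw [D.abs_cellMap_sub_exitPoint b hr hcr, D.abs_cellMap_sub_exitPoint b hr' hcr', pow_succ,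
            div_mul_div_comm, ← div_div, div_eq_mul_one_div]
          refine mul_le_mul_of_nonneg_right (le_trans (div_le_self (by positivity) h1.le) h5)
            (by positivity)
        · have e1 := h.type_ne hr hrr hstrip hcr hcr' hp1
          have e2 := h.type_ne hr hrr hstrip hcr hcr' hq1
          rw [D.cellMap_eq_exitPoint b hr hcr (h.path_eq F hr hδ hv.2.1 e1 e2 hp2 hq2 hust),
            sub_self, abs_zero, zero_mul]
          exact hpos
      · have hcr' := (hstrip c s t hv).resolve_left hcr
        have hstrip2 := fun c s t hv => (hstrip c s t hv).symm
        have e1 := h.type_ne hr' hrr.symm hstrip2 hcr' hcr hp1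
        have e2 := h.type_ne hr' hrr.symm hstrip2 hcr' hcr hq1
        rw [D.cellMap_eq_exitPoint b hr' hcr' (h.path_eq F hr' hδ hv.2.1 e1 e2 hp2 hq2 hust),
          sub_self, abs_zero, mul_zero]
        exact hpos
  have h2 := eq_zero_of_abs_le_pow D.two_le fun n => (abs_of_nonneg (mul_nonneg (abs_nonneg _)
    (abs_nonneg _))).trans_le (key n b γ s₀ t₀ p₀ q₀ hγ hst hp hq u hu)
  rcases mul_eq_zero.1 h2 with h3 | h3
  · exact ⟨r, hr, sub_eq_zero.1 (abs_eq_zero.1 h3)⟩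
  · exact ⟨r', hr', sub_eq_zero.1 (abs_eq_zero.1 h3)⟩

end Straight

end LabyrinthData
end TriLaby
end

noncomputable section
namespace TriLaby

/-! ### Approximation of arcs by finitely many segments -/

open Set Filter Topology
open scoped NNReal

/-- `A` is covered by a set of length at most `C` in finitely many lines `x r = t` and by at most
`N` compact sets of diameter at most `ε`. -/
def Approx (N : ℕ) (ε C : ℝ≥0∞) (A : Set (Fin 3 → ℝ)) : Prop :=
  ∃ (L : Set (Fin 3 × ℝ)) (G : Set (Fin 3 → ℝ)) (U : Finset (Set (Fin 3 → ℝ))),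
    L.Finite ∧ A ⊆ G ∪ ⋃ V ∈ U, V ∧ (∀ x ∈ G, ∃ p ∈ L, x p.1 = p.2) ∧
      Measure.hausdorffMeasure 1 G ≤ C ∧ U.card ≤ N ∧ ∀ V ∈ U, IsCompact V ∧ Metric.ediam V ≤ ε

lemma Approx.mono {N N' : ℕ} {ε C C' : ℝ≥0∞} {A A' : Set (Fin 3 → ℝ)} (h : Approx N ε C A)
    (hN : N ≤ N') (hC : C ≤ C') (hA : A' ⊆ A) : Approx N' ε C' A' := by
  obtain ⟨L, G, U, h1, h2, h3, h4, h5, h6⟩ := h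
  exact ⟨L, G, U, h1, hA.trans h2, h3, h4.trans hC, h5.trans hN, h6⟩

lemma Approx.union {N N' : ℕ} {ε C C' : ℝ≥0∞} {A A' : Set (Fin 3 → ℝ)} (h : Approx N ε C A)
    (h' : Approx N' ε C' A') : Approx (N + N') ε (C + C') (A ∪ A') := by
  classical
  obtain ⟨L, G, U, h1, h2, h3, h4, h5, h6⟩ := h
  obtain ⟨L', G', U', h1', h2', h3', h4', h5', h6'⟩ := h'
  refine ⟨L ∪ L', G ∪ G', U ∪ U', h1.union h1', ?_, ?_, ?_, ?_, ?_⟩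
  · rintro x (hx | hx)
    · rcases h2 hx with h | h
      · exact Or.inl (Or.inl h)
      · simp only [mem_iUnion] at h
        obtain ⟨V, hV, hx⟩ := h
        exact Or.inr (mem_biUnion (Finset.mem_union_left _ hV) hx)
    · rcases h2' hx with h | h
      · exact Or.inl (Or.inr h)
      · simp only [mem_iUnion] at h
        obtain ⟨V, hV, hx⟩ := h
        exact Or.inr (mem_biUnion (Finset.mem_union_right _ hV) hx)
  · rintro x (hx | hx)
    · obtain ⟨p, hp, e⟩ := h3 x hx
      exact ⟨p, Or.inl hp, e⟩
    · obtain ⟨p, hp, e⟩ := h3' x hx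
      exact ⟨p, Or.inr hp, e⟩
  · exact (measure_union_le _ _).trans (add_le_add h4 h4')
  · exact (Finset.card_union_le _ _).trans (add_le_add h5 h5')
  · intro V hV
    rcases Finset.mem_union.1 hV with h | h
    · exact h6 V h
    · exact h6' V h

lemma lipschitzWith_cellMap (m : ℕ) (c : Cell) : LipschitzWith ((m : ℝ≥0)⁻¹) (cellMap m c) := by
  refine LipschitzWith.of_dist_le_mul fun x y => ?_
  refine (dist_pi_le_iff (by positivity)).2 fun r => ?_
  have h : dist (x r) (y r) ≤ dist x y := dist_le_pi_dist x y r
  rw [Real.dist_eq] at h ⊢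
  have h2 : |cellMap m c x r - cellMap m c y r| = |x r - y r| / m := by
    cases c with
    | up k =>
      simp only [cellMap]
      rw [← sub_div, abs_div, Nat.abs_cast]
      congr 2; ring
    | down k =>
      simp only [cellMap]
      rw [← sub_div, abs_div, Nat.abs_cast, abs_sub_comm (x r)]
      congr 2; ring
  rw [h2, div_eq_inv_mul, NNReal.coe_inv, NNReal.coe_natCast]
  gcongr

/-- The line that contains the image of a line under `cellMap`. -/
def cellLine (m : ℕ) : Cell → Fin 3 × ℝ → Fin 3 × ℝ
  | .up k, p => (p.1, (k p.1 + p.2) / m)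
  | .down k, p => (p.1, (k p.1 + 1 - p.2) / m)

lemma cellMap_cellLine {m : ℕ} {c : Cell} {x : Fin 3 → ℝ} {p : Fin 3 × ℝ} (h : x p.1 = p.2) :
    cellMap m c x (cellLine m c p).1 = (cellLine m c p).2 := by
  cases c <;> simp only [cellMap, cellLine, h]

lemma Approx.image {N m : ℕ} {ε C : ℝ≥0∞} {A : Set (Fin 3 → ℝ)} (h : Approx N ε C A) (c : Cell) :
    Approx N (((m : ℝ≥0)⁻¹ : ℝ≥0) * ε) (((m : ℝ≥0)⁻¹ : ℝ≥0) * C) (cellMap m c '' A) := by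
  classical
  obtain ⟨L, G, U, h1, h2, h3, h4, h5, h6⟩ := h
  refine ⟨cellLine m c '' L, cellMap m c '' G, U.image (cellMap m c '' ·), h1.image _, ?_, ?_, ?_,
    Finset.card_image_le.trans h5, ?_⟩
  · rintro _ ⟨x, hx, rfl⟩
    rcases h2 hx with h | h
    · exact Or.inl (mem_image_of_mem _ h)
    · simp only [mem_iUnion] at h
      obtain ⟨V, hV, hx⟩ := h
      exact Or.inr (mem_biUnion (Finset.mem_image_of_mem _ hV) (mem_image_of_mem _ hx))
  · rintro _ ⟨x, hx, rfl⟩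
    obtain ⟨p, hp, e⟩ := h3 x hx
    exact ⟨_, mem_image_of_mem _ hp, cellMap_cellLine e⟩
  · refine ((lipschitzWith_cellMap m c).hausdorffMeasure_image_le zero_le_one G).trans ?_
    rw [ENNReal.rpow_one]
    gcongr
  · intro V hV
    obtain ⟨W, hW, rfl⟩ := Finset.mem_image.1 hV
    refine ⟨(h6 W hW).1.image (continuous_cellMap m c), ?_⟩
    refine ((lipschitzWith_cellMap m c).ediam_image_le W).trans ?_
    gcongr
    exact (h6 W hW).2

/-- In the sup metric the parametrisation by one free coordinate in `[0,1]` is 1-Lipschitz. -/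
lemma hausdorffMeasure_line_le (r : Fin 3) (t : ℝ) :
    Measure.hausdorffMeasure 1 {x : Fin 3 → ℝ | x ∈ stdSimplex ℝ (Fin 3) ∧ x r = t} ≤ 1 := by
  obtain ⟨q, q', hq, hq', hqq, hall⟩ := exists_others r
  let f : ℝ → Fin 3 → ℝ := fun u s => if s = r then t else if s = q then u else 1 - t - u
  have hf : LipschitzWith 1 f := by
    refine LipschitzWith.of_dist_le_mul fun u v => ?_
    rw [NNReal.coe_one, one_mul]
    refine (dist_pi_le_iff dist_nonneg).2 fun s => ?_
    simp only [f]
    split_ifs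
    · simp
    · exact le_rfl
    · rw [dist_sub_left]
  have h1 : {x : Fin 3 → ℝ | x ∈ stdSimplex ℝ (Fin 3) ∧ x r = t} ⊆ f '' Icc 0 1 := by
    rintro x ⟨hx, rfl⟩
    refine ⟨x q, ⟨hx.1 q, simplex_le hx q⟩, ?_⟩
    have hs := simplex_sum hx
    rw [sum_three x hq.symm hq'.symm hqq] at hs
    funext s
    simp only [f]
    split_ifs with e1 e2
    · rw [e1]
    · rw [e2]
    · rcases hall s e1 with rfl | rfl
      · exact absurd rfl e2
      · linarith
  refine (measure_mono h1).trans ((hf.hausdorffMeasure_image_le zero_le_one _).trans ?_)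
  rw [hausdorffMeasure_real, Real.volume_Icc]
  simp

lemma ediam_simplex_le : Metric.ediam (stdSimplex ℝ (Fin 3)) ≤ 1 := by
  refine Metric.ediam_le fun x hx y hy => ?_
  rw [edist_dist, ← ENNReal.ofReal_one]
  refine ENNReal.ofReal_le_ofReal ((dist_pi_le_iff zero_le_one).2 fun r => ?_)
  rw [Real.dist_eq, abs_le]
  constructor <;> linarith [hx.1 r, hy.1 r, simplex_le hx r, simplex_le hy r]

/-- A bound for the length of the approximations. -/
def lengthBound (m : ℕ) : ℝ≥0∞ := 3 * ((grid m).ncard * 3)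

lemma lengthBound_ne_top (m : ℕ) : lengthBound m ≠ ∞ := by
  simp [lengthBound, ENNReal.mul_ne_top]

/-! ### Covering an arc by pieces of exit lines and two end arcs per scale. -/

namespace LabyrinthData

variable {m : ℕ} {pat : Bool → Set Cell} {ex : Bool → Fin 3 → Fin 3 → ℕ}
  {K : Bool → Set (Fin 3 → ℝ)} {D : LabyrinthData m pat ex} {l : Fin 3}

/-- The lines that contain the exits. -/
def exitLines (m : ℕ) (ex : Bool → Fin 3 → Fin 3 → ℕ) (l : Fin 3) (b : Bool) :
    Set (Fin 3 → ℝ) :=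
  ⋃ r : Fin 3, {x | x ∈ stdSimplex ℝ (Fin 3) ∧ x r = exitPoint m ex b l r}

lemma approx_exitLines (D : LabyrinthData m pat ex) (b : Bool) (ε : ℝ≥0∞) :
    Approx 0 ε ((grid m).ncard * 3) (⋃ c : pat b, cellMap m c.1 '' exitLines m ex l (c.1.kind b)) := by
  have := D.finite b
  have := Fintype.ofFinite (pat b)
  refine ⟨⋃ c : pat b, range fun r : Fin 3 =>
    cellLine m c.1 (r, exitPoint m ex (c.1.kind b) l r), _, ∅,
    finite_iUnion fun c => finite_range _, subset_union_left, ?_, ?_, by simp, by simp⟩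
  · intro x hx
    obtain ⟨c, y, hy, rfl⟩ := mem_iUnion.1 hx
    obtain ⟨r, hr⟩ := mem_iUnion.1 hy
    exact ⟨_, mem_iUnion.2 ⟨c, mem_range_self r⟩,
      cellMap_cellLine (p := (r, exitPoint m ex (c.1.kind b) l r)) hr.2⟩
  · refine (measure_iUnion_fintype_le _ _).trans ?_
    have h1 : ∀ c : pat b, Measure.hausdorffMeasure 1
        (cellMap m c.1 '' exitLines m ex l (c.1.kind b)) ≤ 3 := by
      intro c
      refine ((lipschitzWith_cellMap m c.1).hausdorffMeasure_image_le zero_le_one _).trans ?_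
      have h2 : Measure.hausdorffMeasure 1 (exitLines m ex l (c.1.kind b)) ≤ 3 := by
        refine (measure_iUnion_fintype_le _ _).trans ?_
        refine (Finset.sum_le_sum fun r _ => hausdorffMeasure_line_le r _).trans ?_
        simp
      have h3 : (((m : ℝ≥0)⁻¹ : ℝ≥0) : ℝ≥0∞) ^ (1 : ℝ) ≤ 1 := by
        rw [ENNReal.rpow_one, ← ENNReal.coe_one, ENNReal.coe_le_coe]
        have := D.one_lt_cast
        exact inv_le_one_of_one_le₀ (by exact_mod_cast this.le)
      calc _ ≤ 1 * (3 : ℝ≥0∞) := by gcongr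
        _ = 3 := one_mul _
    refine (Finset.sum_le_sum fun c _ => h1 c).trans ?_
    rw [Finset.sum_const, nsmul_eq_mul, Finset.card_univ, ← Nat.card_eq_fintype_card,
      Nat.card_coe_set_eq]
    gcongr
    · exact grid_finite m
    · exact D.sub b

variable {b : Bool} {γ : ℝ → Fin 3 → ℝ} {s₀ t₀ : ℝ}

lemma image_subPath (D : LabyrinthData m pat ex) (hγ : InjPath (K b) γ s₀ t₀) {c : pat b} {s t : ℝ}
    (hv : VisitedDuring γ (piece m pat K b) s₀ t₀ c s t) :
    γ '' Icc s t = cellMap m c.1 '' ((fun u => cellInv m c.1 (γ u)) '' Icc s t) := by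
  rw [image_image]
  exact image_congr fun u hu => ((D.subPath hγ hv).2 u hu).symm

/-- The endpoints of the path are arbitrary, so nothing is known about its first and last visits.
Every other visit begins and ends where another piece is met, hence at exits, and runs on the exit
lines of its cell. -/
lemma StraightAlong.image_subset (F : FractalPair m pat K) (h : D.StraightAlong l)
    (hγ : InjPath (K b) γ s₀ t₀) (hst : s₀ < t₀) :
    ∃ c t c' s, VisitedDuring γ (piece m pat K b) s₀ t₀ c s₀ t ∧
      VisitedDuring γ (piece m pat K b) s₀ t₀ c' s t₀ ∧
      γ '' Icc s₀ t₀ ⊆ (γ '' Icc s₀ t ∪ γ '' Icc s t₀) ∪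
        ⋃ c : pat b, cellMap m c.1 '' exitLines m ex l (c.1.kind b) := by
  have := D.finite b
  have hT := D.treeLike F b
  have hm := fun u hu => exists_piece F (hγ.maps u hu)
  have hs₀ : s₀ ∈ Icc s₀ t₀ := left_mem_Icc.2 hst.le
  have ht₀ : t₀ ∈ Icc s₀ t₀ := right_mem_Icc.2 hst.le
  obtain ⟨c, s', t, hv, hs'⟩ := hT.exists_visited_mem hst hγ.cont hγ.inj hm hs₀
  obtain rfl : s' = s₀ := le_antisymm hs'.1 hv.1
  obtain ⟨c', s, t', hv', ht'⟩ := hT.exists_visited_mem hst hγ.cont hγ.inj hm ht₀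
  obtain rfl : t' = t₀ := le_antisymm hv'.2.2.1 ht'.2
  refine ⟨c, t, c', s, hv, hv', ?_⟩
  rintro _ ⟨u, hu, rfl⟩
  obtain ⟨e, s₁, t₁, he, hue⟩ := hT.exists_visited_mem hst hγ.cont hγ.inj hm hu
  have hmem : γ u ∈ piece m pat K b e := (he.2.2.2 u hu).2 hue
  rcases he.1.eq_or_lt with rfl | hs₁
  · have hmin : min t t₁ ∈ Icc s' t' := ⟨le_min hv.2.1.le he.2.1.le, (min_le_left _ _).trans hv.2.2.1⟩
    -- Two visits starting at the same time overlap in a whole interval, so they belong to the same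
    -- cell.
    obtain rfl := hT.eq_of_visited hγ.inj hs₀ hmin (lt_min hv.2.1 he.2.1).ne hv.left_mem
      ((hv.2.2.2 _ hmin).2 ⟨hmin.1, min_le_left _ _⟩) he.left_mem
      ((he.2.2.2 _ hmin).2 ⟨hmin.1, min_le_right _ _⟩)
    exact Or.inl (Or.inl (mem_image_of_mem _ ((hv.2.2.2 u hu).1 hmem)))
  rcases he.2.2.1.eq_or_lt with rfl | ht₁
  · have hmax : max s s₁ ∈ Icc s' t₁ :=
      ⟨hv'.1.trans (le_max_left _ _), max_le hv'.2.1.le he.2.1.le⟩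
    obtain rfl := hT.eq_of_visited hγ.inj ht₀ hmax (max_lt hv'.2.1 he.2.1).ne' hv'.right_mem
      ((hv'.2.2.2 _ hmax).2 ⟨le_max_left _ _, hmax.2⟩) he.right_mem
      ((he.2.2.2 _ hmax).2 ⟨le_max_right _ _, hmax.2⟩)
    exact Or.inl (Or.inr (mem_image_of_mem _ ((hv'.2.2.2 u hu).1 hmem)))
  · right
    obtain ⟨d, _, _, hd, -, hsd⟩ := hT.exists_prev hγ.cont hγ.inj hm he hs₁
    obtain ⟨p, -, hp⟩ := D.exit_of_mem F hd he.left_mem hsd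
    obtain ⟨d', _, _, hd', -, hsd'⟩ := hT.exists_next hγ.cont hγ.inj hm he ht₁
    obtain ⟨q, -, hq⟩ := D.exit_of_mem F hd' he.right_mem hsd'
    obtain ⟨hδ, hδ'⟩ := D.subPath hγ he
    obtain ⟨r, -, hr⟩ := h.path_mem_lines F hδ he.2.1 hp hq hue
    refine mem_iUnion.2 ⟨e, cellInv m e.1 (γ u), ?_, hδ' u hue⟩
    exact mem_iUnion.2 ⟨r, F.sub_simplex _ (hδ.maps u hue), hr⟩

/-- Arcs of the fractal are covered by sets of bounded length in finitely many lines, and `2 ^ n`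
compact sets of diameter `m ^ (-n)`. -/
lemma StraightAlong.approx (F : FractalPair m pat K) (h : D.StraightAlong l) (n : ℕ) :
    ∀ (b : Bool) (γ : ℝ → Fin 3 → ℝ) (s₀ t₀ : ℝ), InjPath (K b) γ s₀ t₀ → s₀ < t₀ →
      Approx (2 ^ n) ((((m : ℝ≥0)⁻¹ : ℝ≥0) : ℝ≥0∞) ^ n) (lengthBound m) (γ '' Icc s₀ t₀) := by
  induction n with
  | zero =>
    intro b γ s₀ t₀ hγ hst
    refine ⟨∅, ∅, {stdSimplex ℝ (Fin 3)}, finite_empty, ?_, by simp, by simp, by simp, ?_⟩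
    · rintro _ ⟨u, hu, rfl⟩
      simpa using F.sub_simplex _ (hγ.maps u hu)
    · intro V hV
      rw [Finset.mem_singleton.1 hV]
      exact ⟨isCompact_stdSimplex ℝ (Fin 3), by simpa using ediam_simplex_le⟩
  | succ n ih =>
    intro b γ s₀ t₀ hγ hst
    obtain ⟨c, t, c', s, hv, hv', hsub⟩ := h.image_subset F hγ hst
    have h1 := (ih _ _ _ _ (D.subPath hγ hv).1 hv.2.1).image (m := m) c.1
    have h2 := (ih _ _ _ _ (D.subPath hγ hv').1 hv'.2.1).image (m := m) c'.1
    rw [← D.image_subPath hγ hv] at h1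
    rw [← D.image_subPath hγ hv'] at h2
    have h3 := (h1.union h2).union (D.approx_exitLines (l := l) b _)
    rw [pow_succ' (((m : ℝ≥0)⁻¹ : ℝ≥0) : ℝ≥0∞)]
    refine h3.mono (by rw [pow_succ]; omega) ?_ hsub
    -- The bound `lengthBound m` is three times the contribution of the exit lines. For `m ≥ 3` each
    -- end arc, scaled by `1/m`, costs at most one third of it, so the bound reproduces itself.
    have hm : (((m : ℝ≥0)⁻¹ : ℝ≥0) : ℝ≥0∞) * 3 ≤ 1 := by
      have h4 : ((m : ℝ≥0)⁻¹ : ℝ≥0) * 3 ≤ 1 := by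
        have h5 : (3 : ℝ≥0) ≤ m := by exact_mod_cast h.three_le
        have h6 : (0 : ℝ≥0) < m := lt_of_lt_of_le (by norm_num) h5
        rw [inv_mul_le_iff₀ h6, mul_one]
        exact h5
      exact_mod_cast h4
    have h7 : (((m : ℝ≥0)⁻¹ : ℝ≥0) : ℝ≥0∞) * lengthBound m ≤ (grid m).ncard * 3 := by
      rw [lengthBound, ← mul_assoc]
      calc _ ≤ 1 * (((grid m).ncard : ℝ≥0∞) * 3) := by gcongr
        _ = _ := one_mul _
    calc _ ≤ ((grid m).ncard * 3 + (grid m).ncard * 3) + (grid m).ncard * (3 : ℝ≥0∞) := by gcongr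
      _ = lengthBound m := by rw [lengthBound]; ring

end LabyrinthData

/-! ### From coverings to length and local straightness. -/

lemma tendsto_two_pow_mul {m : ℕ} (hm : 3 ≤ m) : Tendsto
    (fun n : ℕ => ((2 ^ n : ℕ) : ℝ≥0∞) * (((m : ℝ≥0)⁻¹ : ℝ≥0) : ℝ≥0∞) ^ n) atTop (𝓝 0) := by
  have h5 : (3 : ℝ≥0) ≤ m := by exact_mod_cast hm
  have h6 : (0 : ℝ≥0) < m := lt_of_lt_of_le (by norm_num) h5
  have h1 : (2 * (m : ℝ≥0)⁻¹ : ℝ≥0) < 1 := by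
    rw [← div_eq_mul_inv, div_lt_one h6]
    exact lt_of_lt_of_le (by norm_num) h5
  have h2 := ENNReal.tendsto_coe.2 (NNReal.tendsto_pow_atTop_nhds_zero_of_lt_one h1)
  refine h2.congr fun n => ?_
  rw [ENNReal.coe_pow, ENNReal.coe_mul, mul_pow]
  norm_cast

lemma tendsto_inv_pow {m : ℕ} (hm : 3 ≤ m) : Tendsto
    (fun n : ℕ => (((m : ℝ≥0)⁻¹ : ℝ≥0) : ℝ≥0∞) ^ n) atTop (𝓝 0) := by
  have h5 : (3 : ℝ≥0) ≤ m := by exact_mod_cast hm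
  have h1 : ((m : ℝ≥0)⁻¹ : ℝ≥0) < 1 := inv_lt_one_of_one_lt₀ (lt_of_lt_of_le (by norm_num) h5)
  have h2 := ENNReal.tendsto_coe.2 (NNReal.tendsto_pow_atTop_nhds_zero_of_lt_one h1)
  refine h2.congr fun n => ?_
  rw [ENNReal.coe_pow]

lemma sum_ediam_le {N : ℕ} {ε : ℝ≥0∞} {U : Finset (Set (Fin 3 → ℝ))} (hN : U.card ≤ N)
    (hU : ∀ V ∈ U, Metric.ediam V ≤ ε) : ∑ V ∈ U, Metric.ediam V ≤ N * ε := by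
  refine (Finset.sum_le_sum hU).trans ?_
  rw [Finset.sum_const, nsmul_eq_mul]
  gcongr

/-- The small sets may have infinite length, so subadditivity of the measure itself is of no use. At
a fixed scale `r`, however, they cost only their diameters once these are below `r`, and the sum of
the diameters tends to zero. -/
lemma hausdorffMeasure_le_of_approx {m : ℕ} (hm : 3 ≤ m) {C : ℝ≥0∞} {A : Set (Fin 3 → ℝ)}
    (h : ∀ n : ℕ, Approx (2 ^ n) ((((m : ℝ≥0)⁻¹ : ℝ≥0) : ℝ≥0∞) ^ n) C A) :
    Measure.hausdorffMeasure 1 A ≤ C := by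
  let f : Set (Fin 3 → ℝ) → ℝ≥0∞ := fun s => Metric.ediam s ^ (1 : ℝ)
  have hH : ∀ s : Set (Fin 3 → ℝ), Measure.hausdorffMeasure 1 s =
      ⨆ (r : ℝ≥0∞) (_ : 0 < r), OuterMeasure.mkMetric'.pre f r s := by
    intro s
    rw [Measure.hausdorffMeasure, ← OuterMeasure.coe_mkMetric, OuterMeasure.mkMetric,
      OuterMeasure.mkMetric']
    simp only [OuterMeasure.iSup_apply]
    rfl
  rw [hH]
  refine iSup₂_le fun r hr => ?_
  have h1 := (tendsto_two_pow_mul hm).const_add C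
  rw [add_zero] at h1
  refine ge_of_tendsto h1 ?_
  filter_upwards [(tendsto_inv_pow hm).eventually (gt_mem_nhds hr)] with n hn
  obtain ⟨L, G, U, -, h2, -, h4, h5, h6⟩ := h n
  calc OuterMeasure.mkMetric'.pre f r A
      ≤ OuterMeasure.mkMetric'.pre f r (G ∪ ⋃ V ∈ U, V) := measure_mono h2
    _ ≤ OuterMeasure.mkMetric'.pre f r G + ∑ V ∈ U, OuterMeasure.mkMetric'.pre f r V :=
        (measure_union_le _ _).trans (add_le_add le_rfl (measure_biUnion_finset_le _ _))
    _ ≤ C + ∑ V ∈ U, Metric.ediam V := by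
        gcongr with V hV
        · refine le_trans ?_ h4
          rw [hH]
          exact le_iSup₂ (f := fun r (_ : 0 < r) => OuterMeasure.mkMetric'.pre f r G) r hr
        · refine (OuterMeasure.mkMetric'.pre_le ((h6 V hV).2.trans hn.le)).trans ?_
          simp [f]
    _ ≤ _ := by
        gcongr
        exact sum_ediam_le h5 fun V hV => (h6 V hV).2

/-- Almost every point of `A` has a neighbourhood in `A` that is contained in a line. -/
lemma ae_eventually_of_approx {m : ℕ} (hm : 3 ≤ m) {C : ℝ≥0∞} {A : Set (Fin 3 → ℝ)}
    (hA : A ⊆ stdSimplex ℝ (Fin 3))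
    (h : ∀ n : ℕ, Approx (2 ^ n) ((((m : ℝ≥0)⁻¹ : ℝ≥0) : ℝ≥0∞) ^ n) C A) :
    Measure.hausdorffMeasure 1 {x | x ∈ A ∧ ¬ ∃ r, ∀ᶠ y in 𝓝[A] x, y r = x r} = 0 := by
  choose L G U h1 h2 h3 h4 h5 h6 using h
  -- The exceptional points: `R` collects those never captured by the line part, `B` the crossings
  -- of two lines of different type.
  let R : Set (Fin 3 → ℝ) := ⋂ n, ⋃ V ∈ U n, V
  let B : Set (Fin 3 → ℝ) := ⋃ p ∈ ⋃ n, L n, ⋃ q ∈ ⋃ n, L n,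
    {x | x ∈ stdSimplex ℝ (Fin 3) ∧ p.1 ≠ q.1 ∧ x p.1 = p.2 ∧ x q.1 = q.2}
  have hR : Measure.hausdorffMeasure 1 R = 0 := by
    have h7 := Measure.hausdorffMeasure_le_liminf_sum (ι := fun n => U n) 1 R (l := atTop) _
      (tendsto_inv_pow hm) (fun n V => V.1) (Eventually.of_forall fun n V => (h6 n V.1 V.2).2)
      (Eventually.of_forall fun n x hx => by
        have := mem_iInter.1 hx n
        simp only [mem_iUnion] at this
        obtain ⟨V, hV, hx⟩ := this
        exact mem_iUnion.2 ⟨⟨V, hV⟩, hx⟩)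
    have h8 : Tendsto (fun n => ∑ V : U n, Metric.ediam V.1 ^ (1 : ℝ)) atTop (𝓝 0) := by
      refine tendsto_of_tendsto_of_tendsto_of_le_of_le tendsto_const_nhds (tendsto_two_pow_mul hm)
        (fun _ => zero_le) fun n => ?_
      simp only [ENNReal.rpow_one]
      rw [Finset.sum_coe_sort (U n) fun V => Metric.ediam V]
      exact sum_ediam_le (h5 n) fun V hV => (h6 n V hV).2
    rw [h8.liminf_eq] at h7
    exact le_antisymm h7 zero_le
  have hB : Measure.hausdorffMeasure 1 B = 0 := by
    have hL : (⋃ n, L n).Countable := countable_iUnion fun n => (h1 n).countable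
    have hBc : B.Countable := hL.biUnion fun p _ => hL.biUnion fun q _ => by
      refine Set.Subsingleton.countable ?_
      rintro x ⟨hx, hpq, hxp, hxq⟩ y ⟨hy, -, hyp, hyq⟩
      obtain ⟨r, hrp, hrq⟩ := exists_other p.1 q.1
      have e1 := simplex_sum hx
      have e2 := simplex_sum hy
      rw [sum_three _ hpq hrp.symm hrq.symm] at e1 e2
      have e3 : x r = y r := by linarith
      funext s
      have : s = p.1 ∨ s = q.1 ∨ s = r := by
        generalize p.1 = p at *
        generalize q.1 = q at *
        clear * - hpq hrp hrq
        revert s p q r; decide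
      rcases this with rfl | rfl | rfl
      · rw [hxp, hyp]
      · rw [hxq, hyq]
      · exact e3
    have := Measure.nullSingletonClass_hausdorff (X := Fin 3 → ℝ) (zero_lt_one (α := ℝ))
    exact hBc.measure_zero _
  refine measure_mono_null (fun x hx => ?_) (measure_union_null hR hB)
  by_contra hxRB
  rw [mem_union, not_or] at hxRB
  refine hx.2 ?_
  obtain ⟨n, hn⟩ : ∃ n, x ∉ ⋃ V ∈ U n, V := by
    by_contra! hall
    exact hxRB.1 (mem_iInter.2 hall)
  have hxG : x ∈ G n := (h2 n hx.1).resolve_right hn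
  obtain ⟨p₀, hp₀, hxp₀⟩ := h3 n x hxG
  have hclosed : IsClosed (⋃ V ∈ U n, V) :=
    (U n).finite_toSet.isClosed_biUnion fun V hV => (h6 n V hV).1.isClosed
  have ev1 : ∀ᶠ y in 𝓝[A] x, y ∉ ⋃ V ∈ U n, V :=
    mem_nhdsWithin_of_mem_nhds (hclosed.isOpen_compl.mem_nhds hn)
  -- Near `x` the finitely many lines not through `x` play no role, and those through `x` are all of
  -- one type because `x ∉ B`.
  have ev2 : ∀ᶠ y in 𝓝[A] x, ∀ p ∈ L n, x p.1 ≠ p.2 → y p.1 ≠ p.2 := by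
    refine (eventually_all_finite (h1 n)).2 fun p _ => ?_
    by_cases hxp : x p.1 = p.2
    · exact Eventually.of_forall fun y hy => absurd hxp hy
    · have : ∀ᶠ y in 𝓝 x, y p.1 ≠ p.2 := (continuous_apply p.1).continuousAt.eventually_ne hxp
      exact mem_nhdsWithin_of_mem_nhds (this.mono fun y hy _ => hy)
  refine ⟨p₀.1, ?_⟩
  filter_upwards [ev1, ev2, self_mem_nhdsWithin] with y hy1 hy2 hyA
  obtain ⟨p, hp, hyp⟩ := h3 n y ((h2 n hyA).resolve_right hy1)
  have hxp : x p.1 = p.2 := by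
    by_contra hne
    exact hy2 p hp hne hyp
  have hpp : p₀.1 = p.1 := by
    by_contra hne
    exact hxRB.2 (mem_biUnion (mem_iUnion.2 ⟨n, hp₀⟩) (mem_biUnion (mem_iUnion.2 ⟨n, hp⟩)
      ⟨hA hx.1, hne, hxp₀, hxp⟩))
  rw [hpp, hyp, hxp]

end TriLaby
end

noncomputable section
namespace TriLaby

/-! ### The data of a labyrinth patterns system -/

/-- The triples of the exits that are described by `k`. -/
def exitTriple (m : ℕ) (k : Fin 3 → ℕ) : Bool → Fin 3 → Fin 3 → ℕ
  | true => ![![0, k 0, m - 1 - k 0], ![k 1, 0, m - 1 - k 1], ![k 2, m - 1 - k 2, 0]]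
  | false => ![![0, m - 1 - k 0, k 0], ![m - 1 - k 1, 0, k 1], ![m - 1 - k 2, k 2, 0]]

lemma whiteExit_eq (m : ℕ) (k : Fin 3 → ℕ) :
    whiteExit m k = fun p => Cell.up (exitTriple m k true p) := by
  funext p; fin_cases p <;> rfl

lemma yellowExit_eq (m : ℕ) (k : Fin 3 → ℕ) :
    yellowExit m k = fun p => Cell.up (exitTriple m k false p) := by
  funext p; fin_cases p <;> rfl

namespace PatternsSystem

variable {m : ℕ} {S : PatternsSystem m}

/-- The patterns of both colours. -/
def pat (S : PatternsSystem m) : Bool → Set Cell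
  | true => S.white
  | false => S.yellow

/-- The exits of both colours. -/
def exitOf (m : ℕ) (k : Fin 3 → ℕ) : Bool → Fin 3 → Cell
  | true => whiteExit m k
  | false => yellowExit m k

lemma exitOf_eq (m : ℕ) (k : Fin 3 → ℕ) (b : Bool) :
    exitOf m k b = fun p => Cell.up (exitTriple m k b p) := by
  cases b
  · exact yellowExit_eq m k
  · exact whiteExit_eq m k

lemma pat_sub (S : PatternsSystem m) (b : Bool) : S.pat b ⊆ grid m := by
  cases b
  · exact S.yellow_sub
  · exact S.white_sub

/-- Replacing only the entry `p` of the triple by the position of `c` gives another exit triple, so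
uniqueness of the triple implies uniqueness of the exits on each side separately. -/
lemma IsExitTriple.unique_white {k : Fin 3 → ℕ} (hk : S.IsExitTriple k)
    (huniq : ∀ k', S.IsExitTriple k' → k' = k) {p : Fin 3} {c d : Fin 3 → ℕ}
    (hc : Cell.up c ∈ S.white) (hd : Cell.up d ∈ S.yellow) (hcp : c p = 0) (hdp : d p = 0)
    (h : ∀ q, q ≠ p → c q + d q + 1 = m) :
    c = exitTriple m k true p ∧ d = exitTriple m k false p := by
  have hg := grid_up (S.white_sub hc)
  have hg' := grid_up (S.yellow_sub hd)
  have key : ∀ v, v < m → c = exitTriple m (Function.update k p v) true p →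
      d = exitTriple m (Function.update k p v) false p →
      c = exitTriple m k true p ∧ d = exitTriple m k false p := by
    intro v hv h1 h2
    have h3 : S.IsExitTriple (Function.update k p v) := by
      refine ⟨fun i => ?_, fun i => ?_⟩
      · by_cases hi : i = p
        · subst hi; simpa using hv
        · simpa [hi] using hk.1 i
      · by_cases hi : i = p
        · subst hi
          rw [whiteExit_eq, yellowExit_eq]
          beta_reduce
          rw [← h1, ← h2]
          exact ⟨hc, hd⟩
        · have e1 : whiteExit m (Function.update k p v) i = whiteExit m k i := by
            have h0 : Function.update k p v i = k i := Function.update_of_ne hi _ _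
            fin_cases i <;> simp_all [whiteExit]
          have e2 : yellowExit m (Function.update k p v) i = yellowExit m k i := by
            have h0 : Function.update k p v i = k i := Function.update_of_ne hi _ _
            fin_cases i <;> simp_all [yellowExit]
          rw [e1, e2]
          exact hk.2 i
    rw [huniq _ h3] at h1 h2
    exact ⟨h1, h2⟩
  have e0 := h 0
  have e1 := h 1
  have e2 := h 2
  fin_cases p
  · simp at hcp hdp e1 e2
    -- The entry of a triple is the second coordinate of the white exit for the first type, and the
    -- first coordinate for the other two.
    refine key (c 1) (by omega) ?_ ?_ <;> funext s <;> fin_cases s <;>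
      simp [exitTriple] <;> omega
  · simp at hcp hdp e0 e2
    refine key (c 0) (by omega) ?_ ?_ <;> funext s <;> fin_cases s <;>
      simp [exitTriple] <;> omega
  · simp at hcp hdp e0 e1
    refine key (c 0) (by omega) ?_ ?_ <;> funext s <;> fin_cases s <;>
      simp [exitTriple] <;> omega

lemma mem_corners {P : Set Cell} (hP : P ⊆ grid m) {k : Fin 3 → ℕ} (hk : Cell.up k ∈ P)
    {q : Fin 3} (hq : k q + 1 = m) : Cell.up k ∈ corners P := by
  refine ⟨hk, k, rfl, ?_⟩
  have hg := grid_up (hP hk)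
  fin_cases q <;> simp at hq ⊢
  · have h1 : k 1 = 0 := by omega
    have h2 : k 2 = 0 := by omega
    simp [h1, h2]
  · have h1 : k 0 = 0 := by omega
    have h2 : k 2 = 0 := by omega
    simp [h1, h2]
  · have h1 : k 0 = 0 := by omega
    have h2 : k 1 = 0 := by omega
    simp [h1, h2]

lemma eq_of_corner (hm : 2 ≤ m) {k : Fin 3 → ℕ} (hk : Cell.up k ∈ grid m) {q r : Fin 3}
    (hq : k q + 1 = m) (hr : k r + 1 = m) : q = r := by
  by_contra hqr
  obtain ⟨s, hsq, hsr⟩ := exists_other q r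
  have hg := grid_up hk
  rw [sum_three k hqr hsq.symm hsr.symm] at hg
  omega

lemma eq_corner {k k' : Fin 3 → ℕ} (hk : Cell.up k ∈ grid m) (hk' : Cell.up k' ∈ grid m)
    {q : Fin 3} (hq : k q + 1 = m) (hr : k' q + 1 = m) : k = k' := by
  have hg := grid_up hk
  have hg' := grid_up hk'
  funext s
  fin_cases q <;> fin_cases s <;> simp at * <;> omega

lemma IsLabyrinth.data (hS : S.IsLabyrinth) (hm : 2 ≤ m) {k : Fin 3 → ℕ} (hk : S.IsExitTriple k) :
    LabyrinthData m S.pat (exitTriple m k) where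
  two_le := hm
  sub := S.pat_sub
  acyclic b := by
    cases b
    · exact hS.yellow_tree.isAcyclic
    · exact hS.white_tree.isAcyclic
  ex_mem b p := by
    have := hk.2 p
    rw [whiteExit_eq, yellowExit_eq] at this
    cases b
    · exact this.2
    · exact this.1
  ex_self b p := by cases b <;> fin_cases p <;> simp [exitTriple]
  ex_mirror b p q hpq := by
    have h0 := hk.1 0
    have h1 := hk.1 1
    have h2 := hk.1 2
    cases b <;> fin_cases p <;> fin_cases q <;> simp [exitTriple] at * <;> omega
  ex_unique b p c d hc hd hcp hdp h := by
    have huniq : ∀ k', S.IsExitTriple k' → k' = k := fun k' hk' => hS.exits.unique hk' hk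
    cases b
    · exact (hk.unique_white huniq hd hc hdp hcp fun q hq => by rw [← h q hq]; ring).2
    · exact (hk.unique_white huniq hc hd hcp hdp h).1
  corner_unique b c d q r hc hd hq hr := by
    have h1 : (corners (S.pat b)).Subsingleton := by
      cases b
      · exact hS.yellow_corners
      · exact hS.white_corners
    have h2 := h1 (mem_corners (S.pat_sub b) hc hq) (mem_corners (S.pat_sub b) hd hr)
    cases h2
    exact eq_of_corner hm (S.pat_sub b hc) hq hr
  corner_ne b c d q r hc hd hq hr hqr := by
    have h1 : Disjoint (corners (S.pat b)) (corners (S.pat (!b))) := by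
      cases b
      · exact hS.corners_disjoint.symm
      · exact hS.corners_disjoint
    subst hqr
    obtain rfl := eq_corner (S.pat_sub _ hc) (S.pat_sub _ hd) hq hr
    exact Set.disjoint_left.1 h1 (mem_corners (S.pat_sub b) hc hq)
      (mem_corners (S.pat_sub (!b)) hd hr)

lemma IsLabyrinth.connected (hS : S.IsLabyrinth) (b : Bool) :
    (cellGraph.induce (S.pat b)).Connected := by
  cases b
  · exact hS.yellow_tree.1
  · exact hS.white_tree.1

/-- Take `l` outside the blocked pair. A pair avoiding some `r ≠ l` is a different pair, hence not
blocked, and its tree path keeps the coordinate `r` of its first cell. -/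
lemma IsLabyrinth.exists_straightAlong (hS : S.IsLabyrinth) (hm : 2 ≤ m) {k : Fin 3 → ℕ}
    (hk : S.IsExitTriple k)
    (hπ : ∃! π : Finset (Fin 3), π ∈ exitPairs ∧ S.IsBlocked π) :
    ∃ l, (hS.data hm hk).StraightAlong l := by
  obtain ⟨π, ⟨hπ1, -⟩, hπ2⟩ := hπ
  obtain ⟨l, hl⟩ : ∃ l, l ∉ π := by
    by_contra! hall
    have h1 : π = Finset.univ := Finset.eq_univ_iff_forall.2 hall
    have h2 := (Finset.mem_powersetCard.1 hπ1).2
    rw [h1] at h2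
    simp at h2
  refine ⟨l, fun b r hr p q hp hq hpq => ?_⟩
  have hrpq : r ∉ ({p, q} : Finset (Fin 3)) := by simp [hp.symm, hq.symm]
  have hne : ({p, q} : Finset (Fin 3)) ≠ π := by
    rintro rfl
    clear * - hr hp hq hpq hl
    revert l r p q; decide
  have hnb : ¬ S.IsBlocked {p, q} := fun hb => hne (hπ2 _ ⟨by
    rw [exitPairs, Finset.mem_powersetCard]
    exact ⟨Finset.subset_univ _, Finset.card_pair hpq⟩, hb⟩)
  have hnb' : ¬ PathBlocked (S.pat b) (fun p => Cell.up (exitTriple m k b p)) {p, q} := by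
    intro hb
    refine hnb ⟨k, hk, ?_⟩
    rw [← exitOf_eq] at hb
    cases b
    · exact Or.inr hb
    · exact Or.inl hb
  obtain ⟨w, hw⟩ := (hS.connected b).exists_isPath ⟨_, (hS.data hm hk).ex_mem b p⟩
    ⟨_, (hS.data hm hk).ex_mem b q⟩
  let f := (SimpleGraph.Embedding.induce (G := cellGraph) (S.pat b)).toHom
  let w' : cellGraph.Walk (Cell.up (exitTriple m k b p)) (Cell.up (exitTriple m k b q)) := w.map f
  have hw' : w'.IsPath := SimpleGraph.Walk.IsPath.map (f := f) Subtype.val_injective hw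
  have hsupp : w'.support = w.support.map Subtype.val := SimpleGraph.Walk.support_map f w
  refine ⟨w, fun c hc => ?_⟩
  by_contra hcr
  refine hnb' ⟨p, q, r, hpq, rfl, hrpq, w', hw', ?_, c.1, ?_,
    Cell.up (exitTriple m k b p), SimpleGraph.Walk.start_mem_support _, hcr⟩
  · intro d hd
    rw [hsupp, List.mem_map] at hd
    obtain ⟨d', -, rfl⟩ := hd
    exact d'.2
  · rw [hsupp, List.mem_map]
    exact ⟨c, hc, rfl⟩

end PatternsSystem
end TriLaby
end

noncomputable section
namespace TriLaby

/-! ### The fractals in barycentric coordinates -/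

open Set

variable (P : AffineBasis (Fin 3) ℝ Plane)

/-- The point with given barycentric coordinates. -/
def baryPoint (z : Fin 3 → ℝ) : Plane := ∑ j, z j • P j

/-- The barycentric coordinates of a point. -/
def bary (x : Plane) : Fin 3 → ℝ := fun i => P.coord i x

lemma map_combination {F : Type*} [AddCommGroup F] [Module ℝ F] (f : Plane →ᵃ[ℝ] F)
    {y : Fin 3 → ℝ} (hy : ∑ i, y i = 1) (B : Fin 3 → Plane) :
    f (∑ i, y i • B i) = ∑ i, y i • f (B i) := by
  have := Finset.univ.map_affineCombination B y hy f
  rwa [Finset.affineCombination_eq_linear_combination _ _ _ hy,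
    Finset.affineCombination_eq_linear_combination _ _ _ hy] at this

lemma sum_bary (x : Plane) : ∑ i, bary P x i = 1 := P.sum_coord_apply_eq_one x

lemma baryPoint_bary (x : Plane) : baryPoint P (bary P x) = x := P.linear_combination_coord_eq_self x

lemma bary_baryPoint {z : Fin 3 → ℝ} (hz : ∑ i, z i = 1) : bary P (baryPoint P z) = z := by
  funext i
  rw [bary, baryPoint, map_combination (P.coord i) hz]
  simp [AffineBasis.coord_apply]

lemma continuous_bary : Continuous (bary P) :=
  continuous_pi fun i => (P.coord i).continuous_of_finiteDimensional

lemma continuous_baryPoint : Continuous (baryPoint P) := by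
  unfold baryPoint; fun_prop

lemma exists_lipschitzWith_baryPoint : ∃ C, LipschitzWith C (baryPoint P) := by
  let f := LinearMap.toContinuousLinearMap (Fintype.linearCombination ℝ P)
  have h1 : baryPoint P = f := by
    funext z
    simp [f, baryPoint, Fintype.linearCombination_apply]
  exact ⟨‖f‖₊, h1 ▸ f.lipschitz⟩

lemma cellTriangle_eq (m : ℕ) (c : Cell) (i : Fin 3) :
    cellTriangle P m c i = baryPoint P (cellMap m c (Pi.single i 1)) := by
  cases c with
  | up k =>
    simp only [cellTriangle, baryPoint, cellMap, Finset.smul_sum, smul_smul, div_eq_inv_mul,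
      Pi.single_apply]
  | down k =>
    simp only [cellTriangle, baryPoint, cellMap, Finset.smul_sum, smul_smul, div_eq_inv_mul,
      Pi.single_apply]
    refine Finset.sum_congr rfl fun j _ => ?_
    congr 2
    split_ifs <;> ring

lemma proj_cellTriangle (m : ℕ) (c : Cell) (x : Plane) :
    proj P (cellTriangle P m c) x = baryPoint P (cellMap m c (bary P x)) := by
  have hs := sum_bary P x
  simp only [proj, cellTriangle_eq, baryPoint, Finset.smul_sum, smul_smul]
  rw [Finset.sum_comm]
  refine Finset.sum_congr rfl fun j _ => ?_
  rw [← Finset.sum_smul]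
  congr 1
  have h1 : ∀ i, P.coord i x = bary P x i := fun i => rfl
  have h2 : ∑ i, bary P x i * (Pi.single i 1 : Fin 3 → ℝ) j = bary P x j := by
    simp [Pi.single_apply]
  simp only [h1]
  rw [Fin.sum_univ_three] at hs h2 ⊢
  cases c with
  | up k =>
    simp only [cellMap]
    rw [← h2]
    linear_combination (k j / m : ℝ) * hs
  | down k =>
    simp only [cellMap]
    rw [← h2]
    linear_combination ((k j + 1) / m : ℝ) * hs

lemma sum_cellMap {m : ℕ} (hm : 2 ≤ m) {c : Cell} (hc : c ∈ grid m) {z : Fin 3 → ℝ}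
    (hz : ∑ i, z i = 1) : ∑ i, cellMap m c z i = 1 := by
  have hm' : (m : ℝ) ≠ 0 := by positivity
  rw [Fin.sum_univ_three] at hz ⊢
  cases c with
  | up k =>
    have hg : (k 0 : ℝ) + k 1 + k 2 + 1 = m := by exact_mod_cast grid_up hc
    simp only [cellMap]
    field_simp
    linarith
  | down k =>
    have hg : (k 0 : ℝ) + k 1 + k 2 + 2 = m := by exact_mod_cast grid_down hc
    simp only [cellMap]
    field_simp
    linarith

lemma cellMap_nonneg {m : ℕ} (c : Cell) {z : Fin 3 → ℝ} (hz : z ∈ stdSimplex ℝ (Fin 3))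
    (r : Fin 3) : 0 ≤ cellMap m c z r := by
  have h1 := hz.1 r
  have h2 := simplex_le hz r
  cases c <;> simp only [cellMap]
  · positivity
  · rename_i k
    have : (0 : ℝ) ≤ k r := by positivity
    exact div_nonneg (by linarith) (by positivity)

/-- The projection map as an affine map. -/
def projAffine (A : Triangle) : Plane →ᵃ[ℝ] Plane :=
  (LinearMap.toSpanSingleton ℝ Plane (A 0)).toAffineMap.comp (P.coord 0) +
    (LinearMap.toSpanSingleton ℝ Plane (A 1)).toAffineMap.comp (P.coord 1) +
    (LinearMap.toSpanSingleton ℝ Plane (A 2)).toAffineMap.comp (P.coord 2)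

lemma projAffine_apply (A : Triangle) (x : Plane) : projAffine P A x = proj P A x := by
  simp [projAffine, proj, Fin.sum_univ_three]

lemma proj_place (A B : Triangle) (x : Plane) : proj P (place P A B) x = proj P A (proj P B x) := by
  have h1 := map_combination (projAffine P A) (sum_bary P x) B
  simp only [projAffine_apply] at h1
  exact h1.symm

lemma place_place (A B C : Triangle) : place P (place P A B) C = place P A (place P B C) :=
  funext fun i => proj_place P A B (C i)

lemma carrier_place (A B : Triangle) : (place P A B).carrier = proj P A '' B.carrier := by
  have h1 : proj P A = projAffine P A := funext fun x => (projAffine_apply P A x).symm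
  have h2 : range (place P A B) = proj P A '' range B := by
    rw [← range_comp]; rfl
  rw [Triangle.carrier, Triangle.carrier, h2, h1, AffineMap.image_convexHull]

lemma carrier_subset {m : ℕ} (hm : 2 ≤ m) {c : Cell} (hc : c ∈ grid m) :
    (cellTriangle P m c).carrier ⊆ convexHull ℝ (range P) := by
  refine convexHull_min ?_ (convex_convexHull ℝ _)
  rintro _ ⟨i, rfl⟩
  have hs : (Pi.single i 1 : Fin 3 → ℝ) ∈ stdSimplex ℝ (Fin 3) := single_mem_stdSimplex ℝ i
  rw [P.convexHull_eq_nonneg_coord, cellTriangle_eq]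
  intro r
  have := congrFun (bary_baryPoint P (sum_cellMap hm hc hs.2)) r
  rw [bary] at this
  rw [this]
  exact cellMap_nonneg c hs r

lemma proj_mem_carrier (A : Triangle) {x : Plane} (hx : x ∈ convexHull ℝ (range P)) :
    proj P A x ∈ A.carrier := by
  rw [P.convexHull_eq_nonneg_coord] at hx
  exact (convex_convexHull ℝ _).sum_mem (fun i _ => hx i) (P.sum_coord_apply_eq_one x)
    fun i _ => subset_convexHull ℝ _ (mem_range_self i)

/-! ### Levels of triangles, their recursion and their nestedness. -/

section

variable {m : ℕ} (own other : Set Cell)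

/-- The union of the triangles of a level. -/
def levelUnion (m : ℕ) (own other : Set Cell) (n : ℕ) : Set Plane :=
  ⋃ A ∈ (level P m own other n).1 ∪ (level P m own other n).2, A.carrier

lemma mem_levelUnion {own other : Set Cell} {n : ℕ} {x : Plane} :
    x ∈ levelUnion P m own other n ↔
      ∃ A, (A ∈ (level P m own other n).1 ∨ A ∈ (level P m own other n).2) ∧ x ∈ A.carrier := by
  simp [levelUnion]

/-- The definition refines the smallest triangles, whereas self-similarity needs the recursion at
the largest ones. Associativity of `place` converts one into the other; inside an upside down cell
both the colours and the orientations are exchanged. -/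
lemma level_succ_subset (n : ℕ) : ∀ own other : Set Cell,
    (level P m own other (n + 1)).1 ⊆
      image2 (place P) (upTriangles P m own) (level P m own other n).1 ∪
        image2 (place P) (downTriangles P m own) (level P m other own n).2 ∧
    (level P m own other (n + 1)).2 ⊆
      image2 (place P) (upTriangles P m own) (level P m own other n).2 ∪
        image2 (place P) (downTriangles P m own) (level P m other own n).1 := by
  induction n with
  | zero => exact fun own other => ⟨subset_rfl, subset_rfl⟩
  | succ n ih =>
    intro own other
    obtain ⟨h1, h2⟩ := ih own other
    constructor
    · rintro _ (⟨A, hA, D, hD, rfl⟩ | ⟨A, hA, D, hD, rfl⟩)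
      · rcases h1 hA with ⟨C, hC, B, hB, rfl⟩ | ⟨C, hC, B, hB, rfl⟩ <;> rw [place_place]
        · exact Or.inl ⟨C, hC, _, Or.inl ⟨B, hB, D, hD, rfl⟩, rfl⟩
        · exact Or.inr ⟨C, hC, _, Or.inr ⟨B, hB, D, hD, rfl⟩, rfl⟩
      · rcases h2 hA with ⟨C, hC, B, hB, rfl⟩ | ⟨C, hC, B, hB, rfl⟩ <;> rw [place_place]
        · exact Or.inl ⟨C, hC, _, Or.inr ⟨B, hB, D, hD, rfl⟩, rfl⟩
        · exact Or.inr ⟨C, hC, _, Or.inl ⟨B, hB, D, hD, rfl⟩, rfl⟩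
    · rintro _ (⟨A, hA, D, hD, rfl⟩ | ⟨A, hA, D, hD, rfl⟩)
      · rcases h1 hA with ⟨C, hC, B, hB, rfl⟩ | ⟨C, hC, B, hB, rfl⟩ <;> rw [place_place]
        · exact Or.inl ⟨C, hC, _, Or.inl ⟨B, hB, D, hD, rfl⟩, rfl⟩
        · exact Or.inr ⟨C, hC, _, Or.inr ⟨B, hB, D, hD, rfl⟩, rfl⟩
      · rcases h2 hA with ⟨C, hC, B, hB, rfl⟩ | ⟨C, hC, B, hB, rfl⟩ <;> rw [place_place]
        · exact Or.inl ⟨C, hC, _, Or.inr ⟨B, hB, D, hD, rfl⟩, rfl⟩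
        · exact Or.inr ⟨C, hC, _, Or.inl ⟨B, hB, D, hD, rfl⟩, rfl⟩

lemma triangles_finite {own : Set Cell} (h : own ⊆ grid m) :
    (upTriangles P m own).Finite ∧ (downTriangles P m own).Finite := by
  have hf := ((grid_finite m).subset h).image (cellTriangle P m)
  constructor
  · refine hf.subset ?_
    rintro _ ⟨k, hk, rfl⟩
    exact mem_image_of_mem _ hk
  · refine hf.subset ?_
    rintro _ ⟨k, hk, rfl⟩
    exact mem_image_of_mem _ hk

variable {own other}

lemma level_finite (h : own ⊆ grid m) (h' : other ⊆ grid m) (n : ℕ) :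
    (level P m own other n).1.Finite ∧ (level P m own other n).2.Finite := by
  obtain ⟨f1, f2⟩ := triangles_finite P h
  obtain ⟨f3, f4⟩ := triangles_finite P h'
  induction n with
  | zero => exact ⟨f1, f2⟩
  | succ n ih => exact ⟨(ih.1.image2 _ f1).union (ih.2.image2 _ f4),
      (ih.1.image2 _ f2).union (ih.2.image2 _ f3)⟩

lemma isClosed_levelUnion (h : own ⊆ grid m) (h' : other ⊆ grid m) (n : ℕ) :
    IsClosed (levelUnion P m own other n) := by
  obtain ⟨f1, f2⟩ := level_finite P h h' n
  exact (f1.union f2).isClosed_biUnion fun A _ => (finite_range A).isClosed_convexHull ℝ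

lemma levelUnion_succ_subset (hm : 2 ≤ m) (h : own ⊆ grid m) (h' : other ⊆ grid m) (n : ℕ) :
    levelUnion P m own other (n + 1) ⊆ levelUnion P m own other n := by
  have key : ∀ A : Triangle, ∀ c ∈ grid m, (place P A (cellTriangle P m c)).carrier ⊆ A.carrier := by
    intro A c hc
    rw [carrier_place]
    rintro _ ⟨x, hx, rfl⟩
    exact proj_mem_carrier P A (carrier_subset P hm hc hx)
  intro x hx
  rw [mem_levelUnion] at hx ⊢
  obtain ⟨_, (⟨A, hA, _, ⟨k, hk, rfl⟩, rfl⟩ | ⟨A, hA, _, ⟨k, hk, rfl⟩, rfl⟩) |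
    (⟨A, hA, _, ⟨k, hk, rfl⟩, rfl⟩ | ⟨A, hA, _, ⟨k, hk, rfl⟩, rfl⟩), hx⟩ := hx
  · exact ⟨A, Or.inl hA, key A _ (h hk) hx⟩
  · exact ⟨A, Or.inr hA, key A _ (h' hk) hx⟩
  · exact ⟨A, Or.inl hA, key A _ (h hk) hx⟩
  · exact ⟨A, Or.inr hA, key A _ (h' hk) hx⟩

lemma levelUnion_zero_subset (hm : 2 ≤ m) (h : own ⊆ grid m) :
    levelUnion P m own other 0 ⊆ convexHull ℝ (range P) := by
  intro x hx
  rw [mem_levelUnion] at hx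
  obtain ⟨_, ⟨k, hk, rfl⟩ | ⟨k, hk, rfl⟩, hx⟩ := hx <;> exact carrier_subset P hm (h hk) hx

end

lemma mem_limitSet {m : ℕ} {own other : Set Cell} {x : Plane} :
    x ∈ limitSet P m own other ↔ ∀ n, x ∈ levelUnion P m own other n := mem_iInter

/-! ### The limit sets as a pair covered by copies of itself. -/

section

variable {m : ℕ} {pat : Bool → Set Cell}

lemma exists_cell_levelUnion {b : Bool} {n : ℕ} {x : Plane}
    (hx : x ∈ levelUnion P m (pat b) (pat (!b)) (n + 1)) :
    ∃ c ∈ pat b, x ∈ proj P (cellTriangle P m c) ''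
      levelUnion P m (pat (c.kind b)) (pat (!(c.kind b))) n := by
  rw [mem_levelUnion] at hx
  obtain ⟨A, hA, hx⟩ := hx
  obtain ⟨h1, h2⟩ := level_succ_subset P (m := m) n (pat b) (pat (!b))
  rcases hA with hA | hA
  · rcases h1 hA with ⟨_, ⟨k, hk, rfl⟩, B, hB, rfl⟩ | ⟨_, ⟨k, hk, rfl⟩, B, hB, rfl⟩ <;>
      rw [carrier_place] at hx <;> refine ⟨_, hk, image_mono ?_ hx⟩ <;> intro y hy <;>
      rw [mem_levelUnion]
    · exact ⟨B, Or.inl hB, hy⟩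
    · simp only [Cell.kind, Bool.not_not]
      exact ⟨B, Or.inr hB, hy⟩
  · rcases h2 hA with ⟨_, ⟨k, hk, rfl⟩, B, hB, rfl⟩ | ⟨_, ⟨k, hk, rfl⟩, B, hB, rfl⟩ <;>
      rw [carrier_place] at hx <;> refine ⟨_, hk, image_mono ?_ hx⟩ <;> intro y hy <;>
      rw [mem_levelUnion]
    · exact ⟨B, Or.inr hB, hy⟩
    · simp only [Cell.kind, Bool.not_not]
      exact ⟨B, Or.inl hB, hy⟩

/-- The fractals in barycentric coordinates. -/
def fractal (m : ℕ) (pat : Bool → Set Cell) (b : Bool) : Set (Fin 3 → ℝ) :=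
  {z | z ∈ stdSimplex ℝ (Fin 3) ∧ baryPoint P z ∈ limitSet P m (pat b) (pat (!b))}

lemma bary_mem_simplex {x : Plane} (hx : x ∈ convexHull ℝ (range P)) :
    bary P x ∈ stdSimplex ℝ (Fin 3) := by
  rw [P.convexHull_eq_nonneg_coord] at hx
  exact ⟨hx, sum_bary P x⟩

lemma bary_mem_fractal (hm : 2 ≤ m) (hp : ∀ b, pat b ⊆ grid m) {b : Bool} {x : Plane}
    (hx : x ∈ limitSet P m (pat b) (pat (!b))) : bary P x ∈ fractal P m pat b := by
  refine ⟨bary_mem_simplex P (levelUnion_zero_subset P hm (hp b) ((mem_limitSet P).1 hx 0)), ?_⟩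
  rwa [baryPoint_bary]

lemma fractalPair (hm : 2 ≤ m) (hp : ∀ b, pat b ⊆ grid m) :
    FractalPair m pat (fractal P m pat) where
  closed b := by
    have h1 : IsClosed (limitSet P m (pat b) (pat (!b))) :=
      isClosed_iInter fun n => isClosed_levelUnion P (hp b) (hp (!b)) n
    exact (isClosed_stdSimplex ℝ (Fin 3)).inter (h1.preimage (continuous_baryPoint P))
  sub_simplex b z hz := hz.1
  cover b z hz := by
    have hanti : ∀ b, Antitone (levelUnion P m (pat b) (pat (!b))) := fun b =>
      antitone_nat_of_succ_le fun n => levelUnion_succ_subset P hm (hp b) (hp (!b)) n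
    have hx := (mem_limitSet P).1 hz.2
    -- If each of the finitely many cells failed at some level, all would fail from a common level
    -- on, since levels are nested; but at each level some cell works.
    obtain ⟨c, hc, hcn⟩ : ∃ c ∈ pat b, ∀ n, baryPoint P z ∈ proj P (cellTriangle P m c) ''
        levelUnion P m (pat (c.kind b)) (pat (!(c.kind b))) n := by
      by_contra! hno
      choose! N hN using hno
      obtain ⟨M, hM⟩ := (((grid_finite m).subset (hp b)).image N).bddAbove
      obtain ⟨c, hc, hx'⟩ := exists_cell_levelUnion P (hx (M + 1))
      exact hN c hc (image_mono (hanti _ (hM (mem_image_of_mem N hc))) hx')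
    have key : ∀ y, proj P (cellTriangle P m c) y = baryPoint P z → z = cellMap m c (bary P y) := by
      intro y hy
      rw [proj_cellTriangle] at hy
      rw [← bary_baryPoint P hz.1.2, ← hy,
        bary_baryPoint P (sum_cellMap hm (hp b hc) (sum_bary P y))]
    obtain ⟨y, hy, hyz⟩ := hcn 0
    refine ⟨c, hc, bary P y, bary_mem_fractal P hm hp ?_, key y hyz⟩
    rw [mem_limitSet]
    intro n
    obtain ⟨y', hy', hyz'⟩ := hcn n
    -- The preimage in the cell does not depend on the level, so a single point lies in all levels.
    have h1 := cellMap_injective hm c ((key y hyz).symm.trans (key y' hyz'))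
    have h2 : y = y' := by rw [← baryPoint_bary P y, h1, baryPoint_bary]
    rwa [h2]

end
end TriLaby
end

noncomputable section
namespace TriLaby

/-! ### Arcs in the plane -/

open Set Filter Topology

/-- A coordinate separating the endpoints is a Lipschitz map sending the arc onto a set containing a
non-degenerate segment. -/
lemma IsArc.one_le_dimH {A : Set Plane} (hA : IsArc A) : 1 ≤ dimH A := by
  obtain ⟨γ, hc, hi, rfl⟩ := hA
  have hne : γ 0 ≠ γ 1 := fun h => zero_ne_one (hi h)
  obtain ⟨r, hr⟩ : ∃ r, γ 0 r ≠ γ 1 r := by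
    by_contra! hall
    exact hne (PiLp.ext hall)
  let f : Plane →L[ℝ] ℝ := EuclideanSpace.proj r
  have h1 : IsPreconnected (f '' range γ) := (isPreconnected_range hc).image f f.continuous.continuousOn
  have h2 : segment ℝ (γ 0 r) (γ 1 r) ⊆ f '' range γ := by
    rw [segment_eq_uIcc]
    exact h1.ordConnected.uIcc_subset ⟨_, mem_range_self 0, rfl⟩ ⟨_, mem_range_self 1, rfl⟩
  calc 1 = dimH (segment ℝ (γ 0 r) (γ 1 r)) := (Real.dimH_segment hr).symm
    _ ≤ dimH (f '' range γ) := dimH_mono h2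
    _ ≤ dimH (range γ) := f.lipschitz.dimH_image_le _

lemma lineAngle_smul {v : Plane} (hv : v ≠ 0) {t : ℝ} (ht : t ≠ 0) : lineAngle v (t • v) ≤ 0 := by
  rcases lt_or_gt_of_ne ht with h | h
  · refine (min_le_right _ _).trans_eq ?_
    rw [← neg_smul, InnerProductGeometry.angle_smul_right_of_pos _ _ (neg_pos.2 h),
      InnerProductGeometry.angle_self hv]
  · refine (min_le_left _ _).trans_eq ?_
    rw [InnerProductGeometry.angle_smul_right_of_pos _ _ h, InnerProductGeometry.angle_self hv]

/-- A set has a tangent at points near which it is contained in a line. -/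
lemma hasTangentAt_of_eventually (P : AffineBasis (Fin 3) ℝ Plane) {A : Set Plane} {x : Plane}
    {r : Fin 3} (h : ∀ᶠ y in 𝓝[A] x, bary P y r = bary P x r) : HasTangentAt A x := by
  obtain ⟨p, q, hp, hq, hpq, -⟩ := exists_others r
  have hv : P p - P q ≠ 0 := sub_ne_zero.2 fun e => hpq (P.ind.injective e)
  refine ⟨P p - P q, hv, fun φ hφ => ?_⟩
  obtain ⟨ε, hε, hball⟩ := Metric.mem_nhdsWithin_iff.1 h
  refine ⟨ε, hε, fun y hy hyx hd => ?_⟩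
  have hyr : bary P y r = bary P x r := hball ⟨by rwa [Metric.mem_ball, dist_comm], hy⟩
  -- With coordinate `r` fixed and total one, the other two coordinates change by opposite amounts.
  have h1 : y - x = (bary P y p - bary P x p) • (P p - P q) := by
    have e1 := baryPoint_bary P y
    have e2 := baryPoint_bary P x
    have s1 := sum_bary P y
    have s2 := sum_bary P x
    rw [baryPoint, Fin.sum_univ_three, sum_three (fun j => bary P _ j • P j) hpq hp hq] at e1 e2
    rw [Fin.sum_univ_three, sum_three _ hpq hp hq] at s1 s2
    have h2 : bary P y q = bary P x p + bary P x q - bary P y p := by linarith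
    have e3 : y - x = (bary P y p • P p + bary P y q • P q + bary P y r • P r) -
        (bary P x p • P p + bary P x q • P q + bary P x r • P r) := by rw [e1, e2]
    rw [e3, hyr, h2]
    module
  have h2 : bary P y p - bary P x p ≠ 0 := by
    intro h0
    rw [h0, zero_smul, sub_eq_zero] at h1
    exact hyx h1
  rw [h1]
  exact (lineAngle_smul hv h2).trans hφ.le

lemma injPath_of_isArc (P : AffineBasis (Fin 3) ℝ Plane) {A : Set Plane} (hA : IsArc A)
    {T : Set (Fin 3 → ℝ)} (hT : ∀ x ∈ A, bary P x ∈ T) :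
    ∃ γ : ℝ → Fin 3 → ℝ, InjPath T γ 0 1 ∧ γ '' Icc 0 1 = bary P '' A := by
  obtain ⟨γ, hc, hi, rfl⟩ := hA
  have hinj : Function.Injective (bary P) := fun x y h => by
    rw [← baryPoint_bary P x, h, baryPoint_bary]
  refine ⟨fun u => bary P (γ (projIcc 0 1 zero_le_one u)), ⟨?_, ?_, ?_⟩, ?_⟩
  · exact ((continuous_bary P).comp (hc.comp continuous_projIcc)).continuousOn
  · intro u hu v hv h
    have := hi (hinj h)
    rw [projIcc_of_mem _ hu, projIcc_of_mem _ hv] at this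
    exact congrArg Subtype.val this
  · exact fun u _ => hT _ (mem_range_self _)
  · ext z
    constructor
    · rintro ⟨u, -, rfl⟩
      exact mem_image_of_mem _ (mem_range_self _)
    · rintro ⟨_, ⟨u, rfl⟩, rfl⟩
      exact ⟨u, u.2, by simp only [projIcc_val]⟩

/-- Arcs in the fractals are rectifiable and have tangents almost everywhere. -/
lemma arc_properties (P : AffineBasis (Fin 3) ℝ Plane) {m : ℕ} {pat : Bool → Set Cell}
    {ex : Bool → Fin 3 → Fin 3 → ℕ} (D : LabyrinthData m pat ex) {l : Fin 3}
    (h : D.StraightAlong l) {b : Bool} {A : Set Plane} (hA : IsArc A)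
    (hAL : A ⊆ limitSet P m (pat b) (pat (!b))) :
    Measure.hausdorffMeasure 1 A < ∞ ∧ dimH A = 1 ∧
      ∀ᵐ x ∂(Measure.hausdorffMeasure 1 : Measure Plane), x ∈ A → HasTangentAt A x := by
  have F := fractalPair P D.two_le D.sub
  have hmem : ∀ x ∈ A, bary P x ∈ fractal P m pat b := fun x hx =>
    bary_mem_fractal P D.two_le D.sub (hAL hx)
  obtain ⟨γ, hγ, hγA⟩ := injPath_of_isArc P hA hmem
  have happ := fun n => h.approx F n b γ 0 1 hγ zero_lt_one
  rw [hγA] at happ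
  obtain ⟨C, hC⟩ := exists_lipschitzWith_baryPoint P
  have hAimg : A = baryPoint P '' (bary P '' A) := by
    rw [image_image]
    simp [baryPoint_bary]
  have hfin : Measure.hausdorffMeasure 1 A < ∞ := by
    rw [hAimg]
    refine (hC.hausdorffMeasure_image_le zero_le_one _).trans_lt ?_
    refine ENNReal.mul_lt_top (by simp) ?_
    exact (hausdorffMeasure_le_of_approx h.three_le happ).trans_lt (lengthBound_ne_top m).lt_top
  refine ⟨hfin, le_antisymm ?_ hA.one_le_dimH, ?_⟩
  · have := dimH_le_of_hausdorffMeasure_ne_top (d := 1) (s := A) (by simpa using hfin.ne)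
    simpa using this
  · have hnull := ae_eventually_of_approx h.three_le
      (by rintro _ ⟨x, hx, rfl⟩; exact (hmem x hx).1) happ
    -- Passing from the sup metric of the coordinates to the Euclidean plane is Lipschitz and
    -- preserves null sets.
    have hnull' : Measure.hausdorffMeasure 1 (baryPoint P '' {x | x ∈ bary P '' A ∧
        ¬ ∃ r, ∀ᶠ y in 𝓝[bary P '' A] x, y r = x r}) = 0 := by
      refine le_antisymm ((hC.hausdorffMeasure_image_le zero_le_one _).trans ?_) zero_le
      rw [hnull, mul_zero]
    refine measure_mono_null (fun x hx => ?_) hnull'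
    rw [mem_compl_iff, mem_ofPred_eq, Classical.not_imp] at hx
    refine ⟨bary P x, ⟨mem_image_of_mem _ hx.1, ?_⟩, baryPoint_bary P x⟩
    rintro ⟨r, hr⟩
    refine hx.2 (hasTangentAt_of_eventually P (r := r) ?_)
    have ht : Tendsto (bary P) (𝓝[A] x) (𝓝[bary P '' A] (bary P x)) :=
      (continuous_bary P).continuousWithinAt.tendsto_nhdsWithin_image
    exact ht.eventually hr

end TriLaby
end
theorem theorem9p5 (P : AffineBasis (Fin 3) ℝ TriLaby.Plane) (m : ℕ) (hm : 2 ≤ m)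
    (S : TriLaby.PatternsSystem m) (hS : S.IsLabyrinth)
    (hπ : ∃! π : Finset (Fin 3), π ∈ TriLaby.exitPairs ∧ S.IsBlocked π)
    (L : Set TriLaby.Plane) (hL : L = S.whiteFractal P ∨ L = S.yellowFractal P)
    (A : Set TriLaby.Plane) (hA : TriLaby.IsArc A) (hAL : A ⊆ L) :
    Measure.hausdorffMeasure 1 A < ∞ ∧
      dimH A = 1 ∧
      ∀ᵐ x ∂(Measure.hausdorffMeasure 1 : Measure TriLaby.Plane),
        x ∈ A → TriLaby.HasTangentAt A x := by
  obtain ⟨k, hk, -⟩ := hS.exits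
  obtain ⟨l, hl⟩ := hS.exists_straightAlong hm hk hπ
  rcases hL with rfl | rfl
  · exact TriLaby.arc_properties P (hS.data hm hk) hl (b := true) hA hAL
  · exact TriLaby.arc_properties P (hS.data hm hk) hl (b := false) hA hAL
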